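/- Let $d\ge 2$ and $0<\varepsilon<1$. In the $d$-dimensional multiple-choice knapsack problem ($d$MCKS) we are given a finite set $\mathcal I$ of pairwise disjoint finite itemsets. Each item $i$ is a cuboid with side lengths $\ell_1(i),\dots,\ell_d(i)\in(0,1]$ and has a profit $p(i)\ge 0$. A feasible solution picks at most one item from each itemset, together with a packing of the picked items, without rotation, into the unit cube $[0,1]^d$ so that no two items overlap (intersect in positive volume). The aim is to maximize the total profit. A feasible solution is $\alpha$-approximate if its profit is at least $\alpha$ times the optimum. *Notation.* Let $\operatorname{type}(x)=q$ for $x\in(\frac1{q+1},\frac1q]$, $q\in\{1,2\}$, and $\operatorname{type}(x)=3$ for $x\le\frac13$. Let $f(x)=1/q$ if $\operatorname{type}(x)=q\in\{1,2\}$, and $f(x)=3x$ if $x\le \frac13$. Let $T$ be the smallest positive constant such that $H:=f/T$ is a weighting function, i.e. $H$ maps $[0,1]$ to $[0,1]$ and $\sum_r H(x_r)\le 1$ whenever $x_1,\dots,x_s\in[0,1]$ and $\sum_r x_r\le 1$. For an item $i$ let $v(i)=\ell_d(i)\prod_{j<d}H(\ell_j(i))$. The base type of $i$ is the vector $(\operatorname{type}(\ell_j(i)))_{j<d}$,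 and its base weight is $\prod_{j<d}f(\ell_j(i))$. To *cut* a sequence of items into shelves is to remove repeatedly the smallest initial segment that has total base weight at least $1$ or is the whole remaining sequence; each segment forms a shelf, whose height is the largest $\ell_d$ in it. *Unit-pack* of a sequence of items, all of the same type vector $(t_1,\dots,t_d)$: if $d=1$, lay the items side by side. If $d>1$, sort the sequence by non-increasing $\ell_d$ if $t_d=3$ (otherwise keep the order), cut it into shelves, pack the bases of the items of each shelf by $(d-1)$-dimensional unit-pack, and stack the shelves. *HDH-NF* (a bin packing of a set of items): for each base type, sort the items of that base type by non-increasing $\ell_d$, cut them into shelves, and pack the base of each shelf by unit-pack. The first shelf of each base type gets a bin of its own; all other shelves are packed into bins by Next-Fit according to their heights. *HDH-KS*: (1) form the one-dimensional multiple-choice knapsack instance $\widehat{\mathcal I}$ with capacity $1$, with the same itemsets and profits, in which item $i$ has size $v(i)$; (2) solve $\widehat{\mathcal I}$ by Lawler's approximation scheme with parameter $\varepsilon$, that is, with $n=|\mathcal I|$ and $P_0$ the larger of the largest single profit and the profit of the greedy algorithm for the linear relaxation, use the dynamic program over undominated pairs (rounded profit, size) for the rounded profits $\lfloor p(i)/K\rfloor$,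 $K=\varepsilon P_0/n$ (if $K=0$, all rounded profits are taken to be $0$); (3) pack the chosen items by HDH-NF; (4) return a most profitable bin (the empty bin if there are none). **Theorem.** HDH-KS is $(1-\varepsilon)3^{-d}$-approximate for $d$MCKS: on every instance it returns a feasible solution (with its packing) whose profit is at least $(1-\varepsilon)3^{-d}$ times the optimum. More precisely, Lawler's scheme returns a $(1-\varepsilon)$-approximate solution of $\widehat{\mathcal I}$, and for every $(1-\varepsilon)$-approximate solution $J$ of $\widehat{\mathcal I}$, HDH-NF produces a valid packing of $J$ into at most $3^d$ bins, and a most profitable one of these bins (the one step (4) selects) is a $(1-\varepsilon)3^{-d}$-approximate solution of the $d$MCKS instance. -/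

import Mathlib

noncomputable section

/-! ### Weighting functions and the harmonic function -/

/-- `g` maps `[0,1]` to `[0,1]`, and whenever finitely many numbers of `[0,1]` sum to at most `1`,
so do their images (a dual feasible function). -/
def IsWeightingFunction (g : ℝ → ℝ) : Prop :=
  (∀ x ∈ Set.Icc (0 : ℝ) 1, g x ∈ Set.Icc (0 : ℝ) 1) ∧
    ∀ (m : ℕ) (x : Fin m → ℝ), 0 < m → (∀ i, x i ∈ Set.Icc (0 : ℝ) 1) →
      ∑ i, x i ≤ 1 → ∑ i, g (x i) ≤ 1

/-- `type_k(x)`: it is `k` if `x ≤ 1/k`, and otherwise the `q` with `1/(q+1) < x ≤ 1/q`,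
which is `q = ⌊1/x⌋`. -/
def harmonicType (k : ℕ) (x : ℝ) : ℕ :=
  if x ≤ 1 / (k : ℝ) then k else ⌊1 / x⌋₊

/-- `f_k(x)`: it is `k x / (k - 2)` if `x ≤ 1/k`, and `1/q` if `1/(q+1) < x ≤ 1/q` with `q < k`. -/
def harmonicF (k : ℕ) (x : ℝ) : ℝ :=
  if x ≤ 1 / (k : ℝ) then (k : ℝ) / ((k : ℝ) - 2) * x else 1 / (harmonicType k x : ℝ)

/-- `T_k`: the smallest positive constant `T` for which `f_k / T` is a weighting function. -/
def harmonicT (k : ℕ) : ℝ :=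
  sInf {T : ℝ | 0 < T ∧ IsWeightingFunction (fun x => harmonicF k x / T)}

/-- The harmonic weighting function `H_k = f_k / T_k`. -/
def harmonicH (k : ℕ) (x : ℝ) : ℝ := harmonicF k x / harmonicT k

/-- The volume of a cuboid, given by its side lengths. -/
def cuboidVol {d : ℕ} (x : Fin d → ℝ) : ℝ := ∏ j, x j

/-- Apply `g` to every side length but the last one (the height). With `g = H_k` this is the
transformation `i ↦ H̃_k(i)`. -/
def mapBase {m : ℕ} (g : ℝ → ℝ) (x : Fin (m + 1) → ℝ) : Fin (m + 1) → ℝ :=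
  fun j => if j = Fin.last m then x j else g (x j)

/-- The side lengths of an item in its base dimensions (all but the last). -/
def baseLen {ι : Type*} {m : ℕ} (len : ι → Fin (m + 1) → ℝ) : ι → Fin m → ℝ :=
  fun i j => len i j.castSucc

/-! ### Packings and the `d`-dimensional multiple-choice knapsack problem -/

/-- The items of `S`, with side lengths `len`, translated to the positions `pos`, form a packing
into the unit cube `[0,1]^d`: each lies in the cube, and no two of them overlap, that is, the
intersection of any two has volume zero. Rotations are not allowed. -/
def IsPacking {ι : Type*} {d : ℕ} (len : ι → Fin d → ℝ) (S : Finset ι)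
    (pos : ι → Fin d → ℝ) : Prop :=
  (∀ i ∈ S, Set.Icc (pos i) (pos i + len i) ⊆ Set.Icc 0 1) ∧
    ∀ i ∈ S, ∀ i' ∈ S, i ≠ i' →
      MeasureTheory.volume
        (Set.Icc (pos i) (pos i + len i) ∩ Set.Icc (pos i') (pos i' + len i')) = 0

/-- The choice constraint: `S` consists of items of the itemsets, at most one from each. -/
def IsChoice {ι : Type*} [DecidableEq ι] (itemsets : Finset (Finset ι)) (S : Finset ι) : Prop :=
  S ⊆ itemsets.biUnion id ∧ ∀ I ∈ itemsets, (S ∩ I).card ≤ 1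

/-- The data of an instance of the `d`-dimensional multiple-choice knapsack problem: a finite set
of itemsets, and for each item its side lengths and its profit. -/
structure MCKS (ι : Type*) (d : ℕ) where
  itemsets : Finset (Finset ι)
  len : ι → Fin d → ℝ
  profit : ι → ℝ

/-- The standing assumptions on an instance: different itemsets share no item, side lengths are
positive and at most `1`, profits are nonnegative. -/
structure MCKS.IsValid {ι : Type*} {d : ℕ} (P : MCKS ι d) : Prop where
  disjoint : ∀ I ∈ P.itemsets, ∀ I' ∈ P.itemsets, I ≠ I' → Disjoint I I'
  len_pos : ∀ I ∈ P.itemsets, ∀ i ∈ I, ∀ j, 0 < P.len i j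
  len_le_one : ∀ I ∈ P.itemsets, ∀ i ∈ I, ∀ j, P.len i j ≤ 1
  profit_nonneg : ∀ I ∈ P.itemsets, ∀ i ∈ I, 0 ≤ P.profit i

/-- A candidate solution: the packed items, with a position for each. -/
structure PackedBin (ι : Type*) (d : ℕ) where
  items : Finset ι
  pos : ι → Fin d → ℝ

/-- A feasible solution: at most one item of each itemset, packed into the unit cube. -/
def MCKS.IsFeasible {ι : Type*} [DecidableEq ι] {d : ℕ} (P : MCKS ι d)
    (B : PackedBin ι d) : Prop :=
  IsChoice P.itemsets B.items ∧ IsPacking P.len B.items B.pos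

/-- A feasible solution whose profit is at least `α` times that of every feasible solution, hence
at least `α` times the optimum. -/
def MCKS.IsApproxSolution {ι : Type*} [DecidableEq ι] {d : ℕ} (P : MCKS ι d) (α : ℝ)
    (B : PackedBin ι d) : Prop :=
  P.IsFeasible B ∧
    ∀ B', P.IsFeasible B' → α * ∑ i ∈ B'.items, P.profit i ≤ ∑ i ∈ B.items, P.profit i

/-! ### One-dimensional multiple-choice knapsack and Lawler's approximation scheme -/

/-- The data of an instance of the one-dimensional multiple-choice knapsack problem, with a
knapsack of capacity `1`. -/
structure MCKS1 (ι : Type*) where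
  itemsets : Finset (Finset ι)
  size : ι → ℝ
  profit : ι → ℝ

namespace MCKS1

variable {ι : Type*} [DecidableEq ι]

/-- The total size of a set of items. -/
def totalSize (P : MCKS1 ι) (S : Finset ι) : ℝ := ∑ i ∈ S, P.size i

/-- The total profit of a set of items. -/
def totalProfit (P : MCKS1 ι) (S : Finset ι) : ℝ := ∑ i ∈ S, P.profit i

/-- A feasible solution: at most one item of each itemset, of total size at most `1`. -/
def IsFeasible (P : MCKS1 ι) (S : Finset ι) : Prop :=
  IsChoice P.itemsets S ∧ P.totalSize S ≤ 1

/-- A feasible solution whose profit is at least `α` times the optimum. -/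
def IsApproxSolution (P : MCKS1 ι) (α : ℝ) (S : Finset ι) : Prop :=
  P.IsFeasible S ∧ ∀ S', P.IsFeasible S' → α * P.totalProfit S' ≤ P.totalProfit S

/-- All pairs of an itemset and an item in it. -/
def allItems (P : MCKS1 ι) : List (Finset ι × ι) :=
  P.itemsets.toList.flatMap fun I => I.toList.map fun i => (I, i)

/-- The profit gained by making `c.2` the chosen item of the itemset `c.1`. -/
def gain (P : MCKS1 ι) (S : Finset ι) (c : Finset ι × ι) : ℝ :=
  P.profit c.2 - P.totalProfit (S ∩ c.1)

/-- The size added by making `c.2` the chosen item of the itemset `c.1`. -/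
def added (P : MCKS1 ι) (S : Finset ι) (c : Finset ι × ι) : ℝ :=
  P.size c.2 - P.totalSize (S ∩ c.1)

/-- Make `c.2` the chosen item of the itemset `c.1`. -/
def exchange (S : Finset ι) (c : Finset ι × ι) : Finset ι := insert c.2 (S \ c.1)

/-- The exchanges that raise both profit and size. -/
def upgrades (P : MCKS1 ι) (S : Finset ι) : List (Finset ι × ι) :=
  P.allItems.filter fun c => decide (0 < P.gain S c ∧ 0 < P.added S c)

/-- The greedy algorithm for the linear relaxation, for at most `t` rounds: always perform the
exchange with the largest ratio of gained profit to added size (so that in each itemset one moves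
along the upper convex hull of its items), until the next exchange no longer fits. -/
def greedy (P : MCKS1 ι) : ℕ → Finset ι → Finset ι
  | 0, S => S
  | t + 1, S =>
    match (P.upgrades S).argmax (fun c => P.gain S c / P.added S c) with
    | none => S
    | some c => if P.totalSize (exchange S c) ≤ 1 then greedy P t (exchange S c) else S

/-- The larger of the greedy profit and the largest profit of a single item. The optimum lies
between this number and twice this number. -/
def lowerBound (P : MCKS1 ι) : ℝ :=
  max ((P.allItems.map fun c => P.profit c.2).foldr max 0)
    (P.totalProfit (P.greedy P.allItems.length ∅))

/-- The unit `K = ε P₀ / n` in which profits are measured, where `P₀` is the lower bound and `n`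
the number of itemsets. -/
def scale (P : MCKS1 ι) (ε : ℝ) : ℝ := ε * P.lowerBound / (P.itemsets.card : ℝ)

/-- The total scaled and rounded profit `∑ ⌊p(i)/K⌋`. -/
def scaledProfit (P : MCKS1 ι) (ε : ℝ) (S : Finset ι) : ℕ :=
  ∑ i ∈ S, ⌊P.profit i / P.scale ε⌋₊

/-- `S` dominates `S'`: at least the same scaled profit at no greater size. -/
def Dominates (P : MCKS1 ι) (ε : ℝ) (S S' : Finset ι) : Prop :=
  P.scaledProfit ε S' ≤ P.scaledProfit ε S ∧ P.totalSize S ≤ P.totalSize S'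

open Classical in
/-- Add `S` to the list of undominated states, unless it exceeds the capacity or is dominated;
states dominated by `S` are removed. -/
def insertState (P : MCKS1 ι) (ε : ℝ) (L : List (Finset ι)) (S : Finset ι) :
    List (Finset ι) :=
  if 1 < P.totalSize S ∨ ∃ S' ∈ L, P.Dominates ε S' S then L
  else S :: L.filter fun S' => decide (¬ P.Dominates ε S S')

/-- One stage of the dynamic program: extend each state by no item or by one item of `I`, and keep
the undominated states. -/
def stage (P : MCKS1 ι) (ε : ℝ) (L : List (Finset ι)) (I : Finset ι) : List (Finset ι) :=
  (L ++ L.flatMap fun S => I.toList.map fun i => insert i S).foldl (P.insertState ε) []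

/-- Lawler's fully polynomial approximation scheme for one-dimensional multiple-choice knapsack:
a dynamic program over the undominated pairs of scaled profit and size. -/
def lawler (P : MCKS1 ι) (ε : ℝ) : Finset ι :=
  (((P.itemsets.toList.foldl (P.stage ε) [∅]).argmax (P.scaledProfit ε)).getD ∅)

end MCKS1

/-! ### Shelves and the algorithm `HDH-NF` -/

/-- A shelf of height `height` in a bin with `m` base dimensions: the items in it, and the positions
of the items in the base dimensions. Every item stands on the bottom of the shelf. -/
structure HarmonicShelf (ι : Type*) (m : ℕ) where
  items : List ι
  height : ℝ
  pos : ι → Fin m → ℝ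

section Algorithm

variable {ι : Type*} [DecidableEq ι]

/-- The positions of the items when shelves are stacked on top of each other, starting at
height `y`. -/
def stackPos {m : ℕ} : ℝ → List (HarmonicShelf ι m) → ι → Fin (m + 1) → ℝ
  | _, [], _ => 0
  | y, S :: L, i =>
    if i ∈ S.items then Fin.snoc (α := fun _ => ℝ) (S.pos i) y
    else stackPos (y + S.height) L i

/-- Cut a sequence into consecutive groups: repeatedly remove the smallest initial segment `J` that
has weight `w(J) ≥ 1` or exhausts the sequence. Here `c` is the weight already collected for the
group under construction, so one starts with `c = 0`. -/
def cutGroups (w : ι → ℝ) : ℝ → List ι → List (List ι)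
  | _, [] => []
  | c, a :: l =>
    if 1 ≤ c + w a then [a] :: cutGroups w 0 l
    else
      match cutGroups w (c + w a) l with
      | [] => [[a]]
      | g :: gs => (a :: g) :: gs

/-- Sort by non-increasing height. -/
def sortByHeight {m : ℕ} (len : ι → Fin (m + 1) → ℝ) (I : List ι) : List ι :=
  I.mergeSort fun a b => decide (len b (Fin.last m) ≤ len a (Fin.last m))

/-- The largest height of an item of `J`. -/
def maxHeight {m : ℕ} (len : ι → Fin (m + 1) → ℝ) (J : List ι) : ℝ :=
  (J.map fun i => len i (Fin.last m)).foldr max 0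

/-- `vol(f_k(i^{(d-1)}))`: the transformed volume of the base of an item. -/
def baseWeight (k : ℕ) {m : ℕ} (len : ι → Fin (m + 1) → ℝ) (i : ι) : ℝ :=
  cuboidVol fun j => harmonicF k (baseLen len i j)

/-- `HDH-unit-pack_k`, in dimension `m + 1`, for a sequence `I` of items of type `t`: the positions
it gives to the items. In dimension one the items are laid side by side. In a higher dimension the
sequence is sorted by height if `t_d = k`, then cut into shelves, each shelf is packed recursively,
and the shelves are stacked. -/
def hdhUnitPack (k : ℕ) :
    (m : ℕ) → (ι → Fin (m + 1) → ℝ) → (Fin (m + 1) → ℕ) → List ι → ι → Fin (m + 1) → ℝ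
  | 0, len, _, I => fun i _ => ((I.takeWhile fun a => decide (a ≠ i)).map fun a => len a 0).sum
  | m + 1, len, t, I =>
    stackPos 0
      ((cutGroups (baseWeight k len) 0
          (if t (Fin.last (m + 1)) = k then sortByHeight len I else I)).map fun J =>
        { items := J
          height := maxHeight len J
          pos := hdhUnitPack k m (baseLen len) (fun j => t j.castSucc) J })

/-- The base type of an item: the vector of the types of its base dimensions. -/
def baseType (k : ℕ) {m : ℕ} (len : ι → Fin (m + 1) → ℝ) (i : ι) : Fin m → ℕ :=
  fun j => harmonicType k (baseLen len i j)

/-- The shelves of base type `t` made by `HDH-SP_k` in dimension `m + 2`, in the order in which they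
are made (which is by non-increasing height). -/
def hdhShelves (k : ℕ) {m : ℕ} (len : ι → Fin (m + 2) → ℝ) (I : List ι)
    (t : Fin (m + 1) → ℕ) : List (HarmonicShelf ι (m + 1)) :=
  (cutGroups (baseWeight k len) 0
      (sortByHeight len (I.filter fun i => decide (baseType k len i = t)))).map fun J =>
    { items := J
      height := maxHeight len J
      pos := hdhUnitPack k m (baseLen len) t J }

/-- Next-Fit with current bin `B`: a shelf goes into the current bin if it fits, and otherwise this
bin is closed and the shelf opens a new one. -/
def nextFitFrom {m : ℕ} : List (HarmonicShelf ι m) → List (HarmonicShelf ι m) → List (List (HarmonicShelf ι m))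
  | B, [] => [B]
  | B, S :: L =>
    if (B.map HarmonicShelf.height).sum + S.height ≤ 1 then nextFitFrom (B ++ [S]) L
    else B :: nextFitFrom [S] L

/-- Next-Fit packing of shelves, as one-dimensional items, into bins of capacity `1`. -/
def nextFit {m : ℕ} : List (HarmonicShelf ι m) → List (List (HarmonicShelf ι m))
  | [] => []
  | S :: L => nextFitFrom [S] L

/-- The packed bin that consists of a stack of shelves. -/
def stackBin {m : ℕ} (B : List (HarmonicShelf ι m)) : PackedBin ι (m + 1) where
  items := (B.flatMap HarmonicShelf.items).toFinset
  pos := stackPos 0 B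

/-- `HDH-NF_k`: a bin packing of the items `I`. For each base type, the first shelf gets a bin of
its own; all other shelves are packed by Next-Fit. -/
def hdhNF (k : ℕ) {m : ℕ} (len : ι → Fin (m + 2) → ℝ) (I : List ι) :
    List (PackedBin ι (m + 2)) :=
  let shelves := ((I.map (baseType k len)).dedup).map (hdhShelves k len I)
  ((shelves.filterMap List.head?).map (fun S => [S]) ++ nextFit (shelves.flatMap List.tail)).map
    stackBin

/-- `L` is a packing of the items `J` into bins: every bin is packed correctly, and every item of
`J` lies in exactly one bin. -/
def IsBinPacking {d : ℕ} (len : ι → Fin d → ℝ) (J : Finset ι) (L : List (PackedBin ι d)) : Prop :=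
  (∀ B ∈ L, IsPacking len B.items B.pos) ∧
    L.Pairwise (fun B B' => Disjoint B.items B'.items) ∧
    ∀ i, i ∈ J ↔ ∃ B ∈ L, i ∈ B.items

/-! ### The algorithm `HDH-KS` -/

/-- The reduction to one dimension: the item `i` is replaced by a one-dimensional item of size
`vol(H̃_3(i))`, with the same profit. -/
def MCKS.reduce {m : ℕ} (P : MCKS ι (m + 1)) : MCKS1 ι where
  itemsets := P.itemsets
  size := fun i => cuboidVol (mapBase (harmonicH 3) (P.len i))
  profit := P.profit

/-- A most profitable bin of a list of bins (the empty bin if there are none). -/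
def mostProfitable {d : ℕ} (profit : ι → ℝ) (L : List (PackedBin ι d)) : PackedBin ι d :=
  (L.argmax fun B => ∑ i ∈ B.items, profit i).getD { items := ∅, pos := 0 }

/-- The part of `HDH-KS` after the one-dimensional problem has been solved by `J`: pack the items of
`J` by `HDH-NF_3` and return a most profitable bin. -/
def MCKS.packBest {m : ℕ} (P : MCKS ι (m + 2)) (J : Finset ι) : PackedBin ι (m + 2) :=
  mostProfitable P.profit (hdhNF 3 P.len J.toList)

/-- The algorithm `HDH-KS` with accuracy parameter `ε`. -/
def MCKS.hdhKS {m : ℕ} (P : MCKS ι (m + 2)) (ε : ℝ) : PackedBin ι (m + 2) :=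
  P.packBest (P.reduce.lawler ε)

end Algorithm

end

noncomputable section

/-! ### The harmonic function for `k = 3` -/

/-! The argument compares the two problems in both directions, losing only the factor `3 ^ d`.

From cuboids to dimension one: `f(x) ≤ 3x`, with equality at `1/3`, so `T = 3` and `H(x) ≤ x`. Hence
`v(i)` is at most the volume of `i`, and packed items have total volume at most `1`. Every feasible
solution of the cuboid problem is therefore feasible for the reduced problem
(`MCKS.IsValid.isFeasible_reduce`), whose optimum is at least as large.

Back from dimension one: a set of total size at most `1` has total base weight times height at most
`3 ^ (d - 1)`. Every shelf has base weight below `1` apart from its last item. This invariant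
suffices for unit-pack and passes to the shelves it makes recursively (`isSeparated_hdhUnitPack`).
Within one base type, each shelf but the first is no higher than any item of the preceding shelf,
which has base weight at least `1`. So all shelves but the first of each type have total height at
most `3 ^ (d - 1)` (`sum_tail_maxHeight_le`), and Next-Fit puts them into at most `2 * 3 ^ (d - 1)`
bins. The first shelves take at most `3 ^ (d - 1)` more, one per base type, for a total of `3 ^ d`
(`hdhNF_length_le`). By averaging, a best bin has at least the fraction `3 ^ (-d)` of the profit.

Lawler's scheme is correct because the dynamic program is exact for the rounded profits: replacing
part of a solution by a dominating state never hurts (`MCKS1.IsValid.isTable_stage`). Rounding costs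
at most `K` for each of at most `n` items, in total `ε P₀`, and `P₀` is itself the profit of a
feasible solution. -/

theorem harmonic_three_cases {x : ℝ} (hx : 0 < x) (hx1 : x ≤ 1) :
    (harmonicType 3 x = 3 ∧ harmonicF 3 x = 3 * x ∧ x ≤ 1 / 3) ∨
      (harmonicType 3 x = 2 ∧ harmonicF 3 x = 1 / 2 ∧ 1 / 3 < x ∧ x ≤ 1 / 2) ∨
      (harmonicType 3 x = 1 ∧ harmonicF 3 x = 1 ∧ 1 / 2 < x) := by
  by_cases h : x ≤ 1 / 3
  · left
    simp only [harmonicType, harmonicF, Nat.cast_ofNat, h, if_true, true_and, and_true]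
    norm_num
  · push Not at h
    by_cases h2 : x ≤ 1 / 2
    · have : harmonicType 3 x = 2 := by
        simp only [harmonicType, Nat.cast_ofNat, not_le.2 h, if_false]
        rw [Nat.floor_eq_iff (by positivity)]
        constructor
        · rw [le_div_iff₀ hx]; push_cast; linarith
        · rw [div_lt_iff₀ hx]; push_cast; linarith
      refine Or.inr (Or.inl ⟨this, ?_, h, h2⟩)
      simp [harmonicF, this, not_le.2 (one_div (3 : ℝ) ▸ h)]
    · push Not at h2
      have : harmonicType 3 x = 1 := by
        simp only [harmonicType, Nat.cast_ofNat, not_le.2 h, if_false]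
        rw [Nat.floor_eq_iff (by positivity)]
        constructor
        · rw [le_div_iff₀ hx]; push_cast; linarith
        · rw [div_lt_iff₀ hx]; push_cast; linarith
      refine Or.inr (Or.inr ⟨this, ?_, h2⟩)
      simp [harmonicF, this, not_le.2 (one_div (3 : ℝ) ▸ h)]

theorem harmonicF_three_zero : harmonicF 3 0 = 0 := by simp [harmonicF]

theorem harmonicF_three_nonneg {x : ℝ} (hx : 0 ≤ x) (hx1 : x ≤ 1) : 0 ≤ harmonicF 3 x := by
  rcases hx.eq_or_lt with rfl | hx
  · exact harmonicF_three_zero.ge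
  · rcases harmonic_three_cases hx hx1 with h | h | h <;> rw [h.2.1] <;> linarith

theorem harmonicF_three_le_one {x : ℝ} (hx : 0 ≤ x) (hx1 : x ≤ 1) : harmonicF 3 x ≤ 1 := by
  rcases hx.eq_or_lt with rfl | hx
  · rw [harmonicF_three_zero]; norm_num
  · rcases harmonic_three_cases hx hx1 with h | h | h <;> rw [h.2.1] <;> linarith

theorem harmonicF_three_le {x : ℝ} (hx : 0 ≤ x) (hx1 : x ≤ 1) : harmonicF 3 x ≤ 3 * x := by
  rcases hx.eq_or_lt with rfl | hx
  · rw [harmonicF_three_zero]; norm_num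
  · rcases harmonic_three_cases hx hx1 with h | h | h <;> rw [h.2.1] <;> linarith

/-- The constant `3` works because `f(x) ≤ 3x`; nothing smaller does, because three numbers `1/3`
sum to `1` and each has `f`-value `1`. -/
theorem harmonicT_three : harmonicT 3 = 3 := by
  refine IsLeast.csInf_eq ⟨⟨by norm_num, ?_, ?_⟩, ?_⟩
  · intro x hx
    have h0 := harmonicF_three_nonneg hx.1 hx.2
    have h1 := harmonicF_three_le_one hx.1 hx.2
    exact ⟨by positivity, by linarith⟩
  · intro m x _ hx hs
    refine (Finset.sum_le_sum fun i _ => ?_).trans hs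
    have := harmonicF_three_le (hx i).1 (hx i).2
    linarith
  · rintro T ⟨hT, -, h⟩
    have := h 3 (fun _ => 1 / 3) (by norm_num) (fun _ => ⟨by norm_num, by norm_num⟩)
      (by norm_num)
    have hf : harmonicF 3 (1 / 3) = 1 := by norm_num [harmonicF]
    simp only [hf, Finset.sum_const, Finset.card_univ, Fintype.card_fin, nsmul_eq_mul] at this
    rw [mul_one_div, div_le_one hT] at this
    exact_mod_cast this

/-! ### Volumes of packed items -/

variable {ι : Type*}

theorem IsPacking.sum_cuboidVol_le_one {d : ℕ} {len : ι → Fin d → ℝ} {S : Finset ι}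
    {pos : ι → Fin d → ℝ} (h : IsPacking len S pos) (hlen : ∀ i ∈ S, ∀ j, 0 ≤ len i j) :
    ∑ i ∈ S, cuboidVol (len i) ≤ 1 := by
  have hvol : ∀ i ∈ S, MeasureTheory.volume (Set.Icc (pos i) (pos i + len i)) =
      ENNReal.ofReal (cuboidVol (len i)) := by
    intro i hi
    rw [Real.volume_Icc_pi, cuboidVol, ENNReal.ofReal_prod_of_nonneg fun j _ => hlen i hi j]
    simp
  have hun := MeasureTheory.measure_biUnion_finset₀ (μ := MeasureTheory.volume) (s := S)
    (f := fun i => Set.Icc (pos i) (pos i + len i))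
    (fun i hi i' hi' hne => h.2 i hi i' hi' hne)
    (fun i _ => measurableSet_Icc.nullMeasurableSet)
  have hle : MeasureTheory.volume (⋃ i ∈ S, Set.Icc (pos i) (pos i + len i)) ≤ 1 := by
    refine (MeasureTheory.measure_mono (Set.iUnion₂_subset h.1)).trans ?_
    rw [Real.volume_Icc_pi]
    simp
  have hnn : ∀ i ∈ S, 0 ≤ cuboidVol (len i) := fun i hi =>
    Finset.prod_nonneg fun j _ => hlen i hi j
  rw [hun, Finset.sum_congr rfl hvol, ← ENNReal.ofReal_sum_of_nonneg hnn, ENNReal.ofReal_le_one] at hle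
  exact hle

/-- The items satisfying `A` lie in the unit cube, and any two of them are separated by a
hyperplane orthogonal to a coordinate axis. -/
def IsSeparated {d : ℕ} (len : ι → Fin d → ℝ) (A : ι → Prop) (pos : ι → Fin d → ℝ) : Prop :=
  (∀ i, A i → ∀ j, 0 ≤ pos i j ∧ pos i j + len i j ≤ 1) ∧
    ∀ i, A i → ∀ i', A i' → i ≠ i' →
      ∃ j, pos i j + len i j ≤ pos i' j ∨ pos i' j + len i' j ≤ pos i j

/-- The intersection of two boxes is a box, and along the separating axis it has nonpositive side
length, hence zero volume. -/
theorem IsSeparated.isPacking {d : ℕ} {len : ι → Fin d → ℝ} {S : Finset ι}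
    {pos : ι → Fin d → ℝ} (h : IsSeparated len (· ∈ S) pos) : IsPacking len S pos := by
  refine ⟨fun i hi => Set.Icc_subset_Icc (fun j => (h.1 i hi j).1) fun j => (h.1 i hi j).2, ?_⟩
  intro i hi i' hi' hne
  obtain ⟨j, hj⟩ := h.2 i hi i' hi' hne
  rw [Set.Icc_inter_Icc, Real.volume_Icc_pi]
  refine Finset.prod_eq_zero (Finset.mem_univ j) (ENNReal.ofReal_eq_zero.2 ?_)
  simp only [Pi.inf_apply, Pi.sup_apply, Pi.add_apply, sub_nonpos]
  rcases hj with hj | hj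
  · exact (inf_le_left.trans hj).trans le_sup_right
  · exact (inf_le_right.trans hj).trans le_sup_left

/-! ### Cutting into groups -/

section Groups

variable {w : ι → ℝ}

/-- The two facts about a group used later: by minimality it has weight below `1` without its last
item, and it reaches weight `1` unless the sequence ran out. The accumulator `c` is general so that
induction over the list applies. -/
theorem exists_cutGroups_eq_cons (c : ℝ) (l : List ι) (hl : l ≠ []) :
    ∃ g l', l = g ++ l' ∧ g ≠ [] ∧ cutGroups w c l = g :: cutGroups w 0 l' ∧
      (c < 1 → c + (g.dropLast.map w).sum < 1) ∧ (l' ≠ [] → 1 ≤ c + (g.map w).sum) := by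
  induction l generalizing c with
  | nil => exact absurd rfl hl
  | cons a l ih =>
    by_cases h : 1 ≤ c + w a
    · exact ⟨[a], l, rfl, by simp, by simp [cutGroups, h], by simp, fun _ => by simpa using h⟩
    · rcases eq_or_ne l [] with rfl | hl'
      · exact ⟨[a], [], rfl, by simp, by simp [cutGroups, h], by simp, by simp⟩
      · obtain ⟨g, l', rfl, hg, hc, h1, h2⟩ := ih (c + w a) hl'
        refine ⟨a :: g, l', rfl, by simp, by simp [cutGroups, h, hc], fun _ => ?_, fun hl => ?_⟩
        · rw [List.dropLast_cons_of_ne_nil hg, List.map_cons, List.sum_cons, ← add_assoc]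
          exact h1 (not_le.1 h)
        · rw [List.map_cons, List.sum_cons, ← add_assoc]
          exact h2 hl

theorem cutGroups_induction {motive : List ι → List (List ι) → Prop} (nil : motive [] [])
    (cons : ∀ g l', g ≠ [] → (g.dropLast.map w).sum < 1 → (l' ≠ [] → 1 ≤ (g.map w).sum) →
      motive l' (cutGroups w 0 l') → motive (g ++ l') (g :: cutGroups w 0 l'))
    (l : List ι) : motive l (cutGroups w 0 l) := by
  induction hn : l.length using Nat.strong_induction_on generalizing l with
  | _ n ih =>
    rcases eq_or_ne l [] with rfl | hl
    · exact nil
    · obtain ⟨g, l', rfl, hg, hc, h1, h2⟩ := exists_cutGroups_eq_cons (w := w) 0 l hl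
      rw [hc]
      refine cons g l' hg (by simpa using h1 one_pos) (by simpa using h2) (ih l'.length ?_ l' rfl)
      have := List.length_pos_iff.2 hg
      rw [← hn, List.length_append]
      omega

theorem cutGroups_flatten (l : List ι) : (cutGroups w 0 l).flatten = l :=
  cutGroups_induction (motive := fun l gs => gs.flatten = l) rfl
    (fun g l' _ _ _ ih => by rw [List.flatten_cons, ih]) l

theorem sum_dropLast_lt_of_mem_cutGroups (l : List ι) :
    ∀ g ∈ cutGroups w 0 l, (g.dropLast.map w).sum < 1 :=
  cutGroups_induction (motive := fun _ gs => ∀ g ∈ gs, (g.dropLast.map w).sum < 1) (by simp)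
    (fun g l' _ hg _ ih => List.forall_mem_cons.2 ⟨hg, ih⟩) l

theorem mem_of_mem_cutGroups {l : List ι} {g : List ι} (hg : g ∈ cutGroups w 0 l) {i : ι}
    (hi : i ∈ g) : i ∈ l := by
  rw [← cutGroups_flatten (w := w) l]
  exact List.mem_flatten.2 ⟨g, hg, hi⟩

/-- Every group that is followed by another uses up weight at least `1`. The last item of the
sequence can be ignored because it lies in the final group, which need not be full. -/
theorem length_cutGroups_le (l : List ι) (hw : ∀ i ∈ l, 0 ≤ w i) (n : ℕ)
    (hn : (l.dropLast.map w).sum < n) : (cutGroups w 0 l).length ≤ n := by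
  refine cutGroups_induction (motive := fun l gs => (∀ i ∈ l, 0 ≤ w i) → ∀ n : ℕ,
    (l.dropLast.map w).sum < n → gs.length ≤ n) (by simp) ?_ l hw n hn
  intro g l' hg _ h1 ih hw n hn
  have hn0 : 0 < n := by
    have : 0 ≤ ((g ++ l').dropLast.map w).sum := by
      refine List.sum_nonneg fun x hx => ?_
      obtain ⟨i, hi, rfl⟩ := List.mem_map.1 hx
      exact hw i (List.mem_of_mem_dropLast hi)
    exact_mod_cast this.trans_lt hn
  rcases eq_or_ne l' [] with rfl | hl'
  · simpa [cutGroups, Nat.one_le_iff_ne_zero] using hn0.ne'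
  · obtain ⟨k, rfl⟩ := Nat.exists_eq_succ_of_ne_zero hn0.ne'
    rw [List.dropLast_append_of_ne_nil hl', List.map_append, List.sum_append] at hn
    have := ih (fun i hi => hw i (List.mem_append_right _ hi)) k
      (by have := h1 hl'; push_cast at hn; linarith)
    simpa using this

end Groups

section Heights

variable {m : ℕ} {len : ι → Fin (m + 1) → ℝ}

theorem maxHeight_le {J : List ι} {c : ℝ} (hc : 0 ≤ c) (h : ∀ i ∈ J, len i (Fin.last m) ≤ c) :
    maxHeight len J ≤ c := by
  induction J with
  | nil => simpa [maxHeight] using hc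
  | cons a J ih =>
    rw [List.forall_mem_cons] at h
    simpa [maxHeight] using ⟨h.1, ih h.2⟩

theorem maxHeight_nonneg (J : List ι) : 0 ≤ maxHeight len J := by
  induction J with
  | nil => simp [maxHeight]
  | cons a J ih =>
    rw [maxHeight, List.map_cons, List.foldr_cons]
    exact le_max_of_le_right ih

theorem le_maxHeight {J : List ι} : ∀ i ∈ J, len i (Fin.last m) ≤ maxHeight len J := by
  induction J with
  | nil => simp
  | cons a J ih =>
    rw [maxHeight, List.map_cons, List.foldr_cons, List.forall_mem_cons]
    exact ⟨le_max_left _ _, fun i hi => le_max_of_le_right (ih i hi)⟩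

/-- The height of each shelf is charged to the preceding one: by the sorting it is at most the
height of every item there, and these items have total weight at least `1`. Only the first shelf has
no predecessor to pay for it. -/
theorem sum_tail_maxHeight_le {w : ι → ℝ} (l : List ι) (hw : ∀ i ∈ l, 0 ≤ w i)
    (hlen : ∀ i ∈ l, 0 ≤ len i (Fin.last m))
    (hs : l.Pairwise fun a b => len b (Fin.last m) ≤ len a (Fin.last m)) :
    (((cutGroups w 0 l).map (maxHeight len)).tail).sum ≤
      (l.map fun i => w i * len i (Fin.last m)).sum := by
  refine cutGroups_induction (motive := fun l gs => (∀ i ∈ l, 0 ≤ w i) →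
    (∀ i ∈ l, 0 ≤ len i (Fin.last m)) →
    (l.Pairwise fun a b => len b (Fin.last m) ≤ len a (Fin.last m)) →
    ((gs.map (maxHeight len)).tail).sum ≤ (l.map fun i => w i * len i (Fin.last m)).sum)
    (by simp) ?_ l hw hlen hs
  intro g l' hg _ h1 ih hw hlen hs
  rw [List.pairwise_append] at hs
  simp only [List.mem_append, or_imp, forall_and] at hw hlen
  rw [List.map_cons, List.tail_cons, List.map_append, List.sum_append]
  have hnn : 0 ≤ (g.map fun i => w i * len i (Fin.last m)).sum := by
    refine List.sum_nonneg fun x hx => ?_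
    obtain ⟨i, hi, rfl⟩ := List.mem_map.1 hx
    exact mul_nonneg (hw.1 i hi) (hlen.1 i hi)
  rcases eq_or_ne l' [] with rfl | hl'
  · simpa [cutGroups] using hnn
  · have ih' := ih hw.2 hlen.2 hs.2.1
    obtain ⟨g', l'', hl, _, hc, -, -⟩ := exists_cutGroups_eq_cons (w := w) 0 l' hl'
    rw [hc, List.map_cons, List.tail_cons] at ih'
    rw [hc, List.map_cons, List.sum_cons]
    refine add_le_add ?_ ih'
    have hM : ∀ i ∈ g, maxHeight len g' ≤ len i (Fin.last m) := fun i hi =>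
      maxHeight_le (hlen.1 i hi) fun b hb => hs.2.2 i hi b (hl ▸ List.mem_append_left _ hb)
    calc maxHeight len g' ≤ (g.map w).sum * maxHeight len g' :=
          le_mul_of_one_le_left (maxHeight_nonneg _) (h1 hl')
      _ = (g.map fun i => w i * maxHeight len g').sum := (List.sum_map_mul_right ..).symm
      _ ≤ _ := List.sum_le_sum fun i hi => mul_le_mul_of_nonneg_left (hM i hi) (hw.1 i hi)

theorem sortByHeight_perm (l : List ι) : (sortByHeight len l).Perm l := List.mergeSort_perm _ _

theorem sortByHeight_pairwise (l : List ι) :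
    (sortByHeight len l).Pairwise fun a b => len b (Fin.last m) ≤ len a (Fin.last m) := by
  have := List.pairwise_mergeSort
    (le := fun a b : ι => decide (len b (Fin.last m) ≤ len a (Fin.last m)))
    (fun a b c hab hbc => by simp only [decide_eq_true_eq] at *; exact hbc.trans hab)
    (fun a b => by simpa using le_total _ _) l
  simpa [sortByHeight] using this

end Heights

/-! ### Stacking shelves -/

section Stack

variable [DecidableEq ι] {m : ℕ}

theorem stackPos_cons (y : ℝ) (S : HarmonicShelf ι m) (L : List (HarmonicShelf ι m)) (i : ι) :
    stackPos y (S :: L) i = if i ∈ S.items then Fin.snoc (α := fun _ => ℝ) (S.pos i) y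
      else stackPos (y + S.height) L i := rfl

/-- A shelf whose base is packed and which is at least as high as its items. -/
structure HarmonicShelf.IsPacked (len : ι → Fin (m + 1) → ℝ) (S : HarmonicShelf ι m) : Prop where
  base : IsSeparated (baseLen len) (· ∈ S.items) S.pos
  le_height : ∀ i ∈ S.items, len i (Fin.last m) ≤ S.height
  height_nonneg : 0 ≤ S.height

variable {len : ι → Fin (m + 1) → ℝ}

theorem stackPos_last_bounds {L : List (HarmonicShelf ι m)} (hL : ∀ S ∈ L, S.IsPacked len)
    (y : ℝ) {i : ι} (hi : i ∈ L.flatMap HarmonicShelf.items) :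
    y ≤ stackPos y L i (Fin.last m) ∧ stackPos y L i (Fin.last m) + len i (Fin.last m) ≤
      y + (L.map HarmonicShelf.height).sum := by
  induction L generalizing y with
  | nil => simp at hi
  | cons S L ih =>
    rw [List.forall_mem_cons] at hL
    rw [stackPos_cons, List.map_cons, List.sum_cons]
    have hs : 0 ≤ (L.map HarmonicShelf.height).sum := by
      refine List.sum_nonneg fun x hx => ?_
      obtain ⟨S', hS', rfl⟩ := List.mem_map.1 hx
      exact (hL.2 S' hS').height_nonneg
    have h0 := hL.1.height_nonneg
    split_ifs with h
    · have := hL.1.le_height i h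
      simp only [Fin.snoc_last, le_refl, true_and]
      linarith
    · have := ih hL.2 (y + S.height) (by simpa [h] using hi)
      constructor <;> linarith [this.1, this.2]

theorem stackPos_base_bounds {L : List (HarmonicShelf ι m)} (hL : ∀ S ∈ L, S.IsPacked len)
    (y : ℝ) {i : ι} (hi : i ∈ L.flatMap HarmonicShelf.items) (j : Fin m) :
    0 ≤ stackPos y L i j.castSucc ∧ stackPos y L i j.castSucc + len i j.castSucc ≤ 1 := by
  induction L generalizing y with
  | nil => simp at hi
  | cons S L ih =>
    rw [List.forall_mem_cons] at hL
    rw [stackPos_cons]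
    split_ifs with h
    · rw [Fin.snoc_castSucc]
      exact hL.1.base.1 i h j
    · exact ih hL.2 _ (by simpa [h] using hi)

/-- Items of the same shelf are separated in the base, items of different shelves by height. Shelves
need not be disjoint, because `stackPos` uses the first shelf that contains the item. -/
theorem stackPos_separated {L : List (HarmonicShelf ι m)} (hL : ∀ S ∈ L, S.IsPacked len)
    (y : ℝ) {i i' : ι} (hi : i ∈ L.flatMap HarmonicShelf.items)
    (hi' : i' ∈ L.flatMap HarmonicShelf.items) (hne : i ≠ i') :
    ∃ j, stackPos y L i j + len i j ≤ stackPos y L i' j ∨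
      stackPos y L i' j + len i' j ≤ stackPos y L i j := by
  induction L generalizing y with
  | nil => simp at hi
  | cons S L ih =>
    rw [List.forall_mem_cons] at hL
    rw [stackPos_cons, stackPos_cons]
    by_cases h : i ∈ S.items <;> by_cases h' : i' ∈ S.items
    · obtain ⟨j, hj⟩ := hL.1.base.2 i h i' h' hne
      refine ⟨j.castSucc, ?_⟩
      rw [if_pos h, if_pos h', Fin.snoc_castSucc, Fin.snoc_castSucc]
      exact hj
    · refine ⟨Fin.last m, Or.inl ?_⟩
      rw [if_pos h, if_neg h', Fin.snoc_last]
      have h1 := (stackPos_last_bounds hL.2 (y + S.height) (i := i') (by simpa [h'] using hi')).1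
      have h2 := hL.1.le_height i h
      linarith
    · refine ⟨Fin.last m, Or.inr ?_⟩
      rw [if_pos h', if_neg h, Fin.snoc_last]
      have h1 := (stackPos_last_bounds hL.2 (y + S.height) (i := i) (by simpa [h] using hi)).1
      have h2 := hL.1.le_height i' h'
      linarith
    · rw [if_neg h, if_neg h']
      exact ih hL.2 _ (by simpa [h] using hi) (by simpa [h'] using hi')

theorem isSeparated_stackPos {L : List (HarmonicShelf ι m)} (hL : ∀ S ∈ L, S.IsPacked len)
    (hs : (L.map HarmonicShelf.height).sum ≤ 1) :
    IsSeparated len (· ∈ L.flatMap HarmonicShelf.items) (stackPos 0 L) := by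
  refine ⟨fun i hi j => ?_, fun i hi i' hi' hne => stackPos_separated hL 0 hi hi' hne⟩
  induction j using Fin.lastCases with
  | last =>
    have := stackPos_last_bounds hL 0 hi
    exact ⟨this.1, this.2.trans (by simpa using hs)⟩
  | cast j => exact stackPos_base_bounds hL 0 hi j

end Stack

/-! ### Unit-pack -/

section UnitPack

/-- The product of the values of the harmonic function at all side lengths. -/
def harmonicWeight {d : ℕ} (x : Fin d → ℝ) : ℝ := ∏ j, harmonicF 3 (x j)

/-- All side lengths lie in `(0,1]`. -/
def IsBox {d : ℕ} (x : Fin d → ℝ) : Prop := ∀ j, 0 < x j ∧ x j ≤ 1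

theorem IsBox.harmonicWeight_nonneg {d : ℕ} {x : Fin d → ℝ} (h : IsBox x) :
    0 ≤ harmonicWeight x :=
  Finset.prod_nonneg fun j _ => harmonicF_three_nonneg (h j).1.le (h j).2

theorem IsBox.harmonicWeight_le_one {d : ℕ} {x : Fin d → ℝ} (h : IsBox x) :
    harmonicWeight x ≤ 1 :=
  Finset.prod_le_one (fun j _ => harmonicF_three_nonneg (h j).1.le (h j).2)
    fun j _ => harmonicF_three_le_one (h j).1.le (h j).2

theorem harmonicWeight_succ {m : ℕ} (len : ι → Fin (m + 1) → ℝ) (i : ι) :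
    harmonicWeight (len i) = baseWeight 3 len i * harmonicF 3 (len i (Fin.last m)) :=
  Fin.prod_univ_castSucc _

theorem IsBox.baseLen {m : ℕ} {len : ι → Fin (m + 1) → ℝ} {i : ι} (h : IsBox (len i)) :
    IsBox (baseLen len i) := fun j => h j.castSucc

theorem sum_map_maxHeight_le {m : ℕ} {len : ι → Fin (m + 1) → ℝ} (gs : List (List ι)) {c : ℝ}
    (hc : 0 ≤ c) (h : ∀ g ∈ gs, ∀ i ∈ g, len i (Fin.last m) ≤ c) {n : ℕ} (hn : gs.length ≤ n) :
    (gs.map (maxHeight len)).sum ≤ n * c := by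
  refine (List.sum_le_card_nsmul _ c fun x hx => ?_).trans ?_
  · obtain ⟨g, hg, rfl⟩ := List.mem_map.1 hx
    exact maxHeight_le hc (h g hg)
  · rw [List.length_map, nsmul_eq_mul]
    gcongr

/-- Sequences of items that unit-pack can handle: the total weight of all items but the last is
less than `1`. The shelves it makes then have total height at most `1`. -/
theorem sum_unitPack_heights_le_one {m : ℕ} {len : ι → Fin (m + 1) → ℝ} {q : ℕ} {I : List ι}
    (hbox : ∀ i ∈ I, IsBox (len i)) (hq : ∀ i ∈ I, harmonicType 3 (len i (Fin.last m)) = q)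
    (hI : (I.dropLast.map fun i => harmonicWeight (len i)).sum < 1) :
    (((cutGroups (baseWeight 3 len) 0 (if q = 3 then sortByHeight len I else I)).map
      (maxHeight len)).sum) ≤ 1 := by
  rcases eq_or_ne I [] with rfl | hne
  · simp [sortByHeight, cutGroups]
  have hw : ∀ i ∈ I, 0 ≤ baseWeight 3 len i := fun i hi => (hbox i hi).baseLen.harmonicWeight_nonneg
  have hcases := fun i hi => harmonic_three_cases ((hbox i hi) (Fin.last m)).1
    ((hbox i hi) (Fin.last m)).2
  -- If `f` takes the constant value `c = 1/q` at all heights, the weight condition says that the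
  -- base weights of all items but the last sum to less than `q`. So there are at most `q` shelves,
  -- each of height at most `1/q`.
  have hscale : ∀ c : ℝ, (∀ i ∈ I, harmonicF 3 (len i (Fin.last m)) = c) →
      (I.dropLast.map (baseWeight 3 len)).sum * c < 1 := by
    intro c hc
    rw [← List.sum_map_mul_right]
    refine (congrArg List.sum (List.map_congr_left fun i hi => ?_)).trans_lt hI
    rw [harmonicWeight_succ, hc i (List.mem_of_mem_dropLast hi)]
  obtain ⟨a, ha⟩ := List.exists_mem_of_ne_nil I hne
  rcases hcases a ha with h3 | h2 | h1
  · have hq3 : q = 3 := (hq a ha).symm.trans h3.1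
    subst hq3
    have hf : ∀ i ∈ I, harmonicF 3 (len i (Fin.last m)) = 3 * len i (Fin.last m) ∧
        len i (Fin.last m) ≤ 1 / 3 := by
      intro i hi
      rcases hcases i hi with h | h | h
      · exact h.2
      · have := h.1.symm.trans (hq i hi); omega
      · have := h.1.symm.trans (hq i hi); omega
    rw [if_pos rfl]
    have hperm := sortByHeight_perm (len := len) I
    -- For type `3` the unit height splits into three thirds: one for the first shelf, one for the
    -- last item of `I`, which the weight condition omits, and one for base weight times height of
    -- all other items. The slope `3` of `f` serves to make this last part less than `1/3`.
    have htail := sum_tail_maxHeight_le (len := len) (w := baseWeight 3 len) (sortByHeight len I)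
      (fun i hi => hw i (hperm.mem_iff.1 hi))
      (fun i hi => (hbox i (hperm.mem_iff.1 hi) _).1.le) (sortByHeight_pairwise I)
    rw [(hperm.map _).sum_eq, ← List.dropLast_append_getLast hne, List.map_append,
      List.sum_append, List.dropLast_append_getLast hne] at htail
    have hlast := List.getLast_mem hne
    have e1 : (I.dropLast.map fun i => baseWeight 3 len i * len i (Fin.last m)).sum * 3 < 1 := by
      rw [← List.sum_map_mul_right]
      refine (congrArg List.sum (List.map_congr_left fun i hi => ?_)).trans_lt hI
      rw [harmonicWeight_succ, (hf i (List.mem_of_mem_dropLast hi)).1]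
      ring
    have e2 : baseWeight 3 len (I.getLast hne) * len (I.getLast hne) (Fin.last m) ≤ 1 / 3 := by
      refine (mul_le_of_le_one_left (hbox _ hlast _).1.le ?_).trans (hf _ hlast).2
      exact (hbox _ hlast).baseLen.harmonicWeight_le_one
    simp only [List.map_cons, List.map_nil, List.sum_cons, List.sum_nil, add_zero] at htail
    obtain ⟨g, l', hl, _, hc, -, -⟩ := exists_cutGroups_eq_cons (w := baseWeight 3 len) 0
      (sortByHeight len I) (fun h => hne (by simpa [h] using hperm.symm))
    rw [hc, List.map_cons, List.tail_cons] at htail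
    rw [hc, List.map_cons, List.sum_cons]
    have e3 : maxHeight len g ≤ 1 / 3 := maxHeight_le (by norm_num) fun i hi =>
      (hf i (hperm.mem_iff.1 (hl ▸ List.mem_append_left _ hi))).2
    linarith
  · have hq2 : q = 2 := (hq a ha).symm.trans h2.1
    subst hq2
    have hf : ∀ i ∈ I, harmonicF 3 (len i (Fin.last m)) = 1 / 2 ∧
        len i (Fin.last m) ≤ 1 / 2 := by
      intro i hi
      rcases hcases i hi with h | h | h
      · have := h.1.symm.trans (hq i hi); omega
      · exact ⟨h.2.1, h.2.2.2⟩
      · have := h.1.symm.trans (hq i hi); omega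
    rw [if_neg (by norm_num)]
    -- Leaving the sequence unsorted matters here: the weight condition singles out the last item in
    -- the given order, and so does the count of groups.
    have hs := hscale _ fun i hi => (hf i hi).1
    have hlen := length_cutGroups_le (w := baseWeight 3 len) I hw 2 (by push_cast; linarith)
    refine (sum_map_maxHeight_le _ (c := 1 / 2) (by norm_num)
      (fun g hg i hi => (hf i (mem_of_mem_cutGroups hg hi)).2) hlen).trans ?_
    norm_num
  · have hq1 : q = 1 := (hq a ha).symm.trans h1.1
    subst hq1
    have hf : ∀ i ∈ I, harmonicF 3 (len i (Fin.last m)) = 1 := by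
      intro i hi
      rcases hcases i hi with h | h | h
      · have := h.1.symm.trans (hq i hi); omega
      · have := h.1.symm.trans (hq i hi); omega
      · exact h.2.1
    rw [if_neg (by norm_num)]
    have hs := hscale _ hf
    have hlen := length_cutGroups_le (w := baseWeight 3 len) I hw 1 (by push_cast; linarith)
    refine (sum_map_maxHeight_le _ (c := 1) (by norm_num)
      (fun g hg i hi => (hbox i (mem_of_mem_cutGroups hg hi) _).2) hlen).trans ?_
    norm_num

/-- In dimension one the base weight is an empty product, so every item forms a shelf of its own and
the bound on shelf heights applies. -/
theorem sum_len_le_one {len : ι → Fin 1 → ℝ} {q : ℕ} {I : List ι}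
    (hbox : ∀ i ∈ I, IsBox (len i)) (hq : ∀ i ∈ I, harmonicType 3 (len i 0) = q)
    (hI : (I.dropLast.map fun i => harmonicWeight (len i)).sum < 1) :
    (I.map fun i => len i 0).sum ≤ 1 := by
  have hgroup : ∀ l : List ι, (cutGroups (baseWeight 3 len) 0 l).map (maxHeight len) =
      l.map fun i => max (len i 0) 0 := by
    intro l
    induction l with
    | nil => rfl
    | cons a l ih =>
      have : baseWeight 3 len a = 1 := by simp [baseWeight, cuboidVol]
      simp [cutGroups, this, ih, maxHeight]
  have h := sum_unitPack_heights_le_one hbox hq hI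
  rw [hgroup] at h
  refine le_trans ?_ h
  have hperm : (if q = 3 then sortByHeight len I else I).Perm I := by
    split_ifs
    exacts [sortByHeight_perm I, List.Perm.refl I]
  rw [(hperm.map _).sum_eq]
  exact List.sum_le_sum fun i _ => le_max_left _ _

variable [DecidableEq ι]

theorem sum_takeWhile_ne_bounds {x : ι → ℝ} {I : List ι} (hx : ∀ i ∈ I, 0 ≤ x i) {i : ι}
    (hi : i ∈ I) :
    0 ≤ ((I.takeWhile fun a => decide (a ≠ i)).map x).sum ∧
      ((I.takeWhile fun a => decide (a ≠ i)).map x).sum + x i ≤ (I.map x).sum := by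
  induction I with
  | nil => simp at hi
  | cons a I ih =>
    rw [List.forall_mem_cons] at hx
    have hs : 0 ≤ (I.map x).sum := by
      refine List.sum_nonneg fun z hz => ?_
      obtain ⟨b, hb, rfl⟩ := List.mem_map.1 hz
      exact hx.2 b hb
    by_cases h : a = i
    · subst h
      simpa using hs
    · have := ih hx.2 ((List.mem_cons.1 hi).resolve_left (Ne.symm h))
      rw [List.takeWhile_cons_of_pos (by simpa using h)]
      simp only [List.map_cons, List.sum_cons]
      constructor <;> linarith [this.1, this.2, hx.1]

/-- Whichever item first occurs earlier belongs, with everything before it, to the prefix that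
determines the position of the other. -/
theorem sum_takeWhile_ne_separated {x : ι → ℝ} {I : List ι} (hx : ∀ i ∈ I, 0 ≤ x i) {i i' : ι}
    (hi : i ∈ I) (hi' : i' ∈ I) (hne : i ≠ i') :
    ((I.takeWhile fun a => decide (a ≠ i)).map x).sum + x i ≤
        ((I.takeWhile fun a => decide (a ≠ i')).map x).sum ∨
      ((I.takeWhile fun a => decide (a ≠ i')).map x).sum + x i' ≤
        ((I.takeWhile fun a => decide (a ≠ i)).map x).sum := by
  induction I with
  | nil => simp at hi
  | cons a I ih =>
    rw [List.forall_mem_cons] at hx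
    by_cases h : a = i
    · subst h
      left
      have := (sum_takeWhile_ne_bounds hx.2 ((List.mem_cons.1 hi').resolve_left hne.symm)).1
      rw [List.takeWhile_cons_of_pos (p := fun b => decide (b ≠ i')) (by simpa using hne)]
      simpa using this
    · by_cases h' : a = i'
      · subst h'
        right
        have := (sum_takeWhile_ne_bounds hx.2 ((List.mem_cons.1 hi).resolve_left hne)).1
        rw [List.takeWhile_cons_of_pos (p := fun b => decide (b ≠ i)) (by simpa using h)]
        simpa using this
      · have := ih hx.2 ((List.mem_cons.1 hi).resolve_left (Ne.symm h))
          ((List.mem_cons.1 hi').resolve_left (Ne.symm h'))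
        rw [List.takeWhile_cons_of_pos (a := a) (by simpa using h),
          List.takeWhile_cons_of_pos (a := a) (by simpa using h')]
        simp only [List.map_cons, List.sum_cons, add_assoc, add_le_add_iff_left]
        exact this

/-- Induction on the dimension. The base weight is the full weight of the base, so the way shelves
are cut gives each of them the same condition one dimension lower. -/
theorem isSeparated_hdhUnitPack (m : ℕ) (len : ι → Fin (m + 1) → ℝ) (t : Fin (m + 1) → ℕ)
    (I : List ι) (hbox : ∀ i ∈ I, IsBox (len i))
    (ht : ∀ i ∈ I, ∀ j, harmonicType 3 (len i j) = t j)
    (hI : (I.dropLast.map fun i => harmonicWeight (len i)).sum < 1) :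
    IsSeparated len (· ∈ I) (hdhUnitPack 3 m len t I) := by
  induction m generalizing I with
  | zero =>
    have hx : ∀ i ∈ I, 0 ≤ len i 0 := fun i hi => (hbox i hi 0).1.le
    constructor
    · intro i hi j
      rw [Fin.fin_one_eq_zero j]
      have := sum_takeWhile_ne_bounds hx hi
      exact ⟨this.1, this.2.trans (sum_len_le_one hbox (fun i hi => ht i hi 0) hI)⟩
    · exact fun i hi i' hi' hne => ⟨0, sum_takeWhile_ne_separated hx hi hi' hne⟩
  | succ m ih =>
    have hperm : (if t (Fin.last (m + 1)) = 3 then sortByHeight len I else I).Perm I := by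
      split_ifs
      exacts [sortByHeight_perm I, List.Perm.refl I]
    have hsum := sum_unitPack_heights_le_one hbox (fun i hi => ht i hi (Fin.last _)) hI
    rw [hdhUnitPack]
    set l := if t (Fin.last (m + 1)) = 3 then sortByHeight len I else I with hl
    have key := isSeparated_stackPos (len := len)
      (L := (cutGroups (baseWeight 3 len) 0 l).map fun J =>
        { items := J
          height := maxHeight len J
          pos := hdhUnitPack 3 m (baseLen len) (fun j => t j.castSucc) J }) ?_ ?_
    · have hmem : ∀ i, i ∈ I ↔ i ∈ ((cutGroups (baseWeight 3 len) 0 l).map fun J =>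
          ({ items := J
             height := maxHeight len J
             pos := hdhUnitPack 3 m (baseLen len) (fun j => t j.castSucc) J } :
            HarmonicShelf ι (m + 1))).flatMap HarmonicShelf.items := by
        intro i
        rw [List.flatMap_map, List.flatMap_id', cutGroups_flatten]
        exact hperm.mem_iff.symm
      exact ⟨fun i hi => key.1 i ((hmem i).1 hi), fun i hi i' hi' =>
        key.2 i ((hmem i).1 hi) i' ((hmem i').1 hi')⟩
    · intro S hS
      obtain ⟨J, hJ, rfl⟩ := List.mem_map.1 hS
      have hJI : ∀ i ∈ J, i ∈ I := fun i hi => hperm.mem_iff.1 (mem_of_mem_cutGroups hJ hi)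
      exact ⟨ih (baseLen len) _ J (fun i hi => (hbox i (hJI i hi)).baseLen)
        (fun i hi j => ht i (hJI i hi) j.castSucc) (sum_dropLast_lt_of_mem_cutGroups l J hJ),
        le_maxHeight, maxHeight_nonneg J⟩
    · simpa [Function.comp_def] using hsum

end UnitPack

/-! ### Next-Fit -/

section NextFit

variable {m : ℕ}

theorem nextFitFrom_flatten (B L : List (HarmonicShelf ι m)) :
    (nextFitFrom B L).flatten = B ++ L := by
  induction L generalizing B with
  | nil => simp [nextFitFrom]
  | cons S L ih =>
    rw [nextFitFrom]
    split_ifs <;> simp [ih]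

theorem nextFit_flatten (L : List (HarmonicShelf ι m)) : (nextFit L).flatten = L := by
  cases L with
  | nil => rfl
  | cons S L => exact nextFitFrom_flatten [S] L

theorem sum_height_le_one_of_mem_nextFitFrom {B L : List (HarmonicShelf ι m)}
    (hB : (B.map HarmonicShelf.height).sum ≤ 1) (hL : ∀ S ∈ L, S.height ≤ 1) :
    ∀ C ∈ nextFitFrom B L, (C.map HarmonicShelf.height).sum ≤ 1 := by
  induction L generalizing B with
  | nil => simpa [nextFitFrom] using hB
  | cons S L ih =>
    rw [List.forall_mem_cons] at hL
    rw [nextFitFrom]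
    split_ifs with h
    · exact ih (by simpa using h) hL.2
    · exact List.forall_mem_cons.2 ⟨hB, ih (by simpa using hL.1) hL.2⟩

theorem sum_height_le_one_of_mem_nextFit {L : List (HarmonicShelf ι m)}
    (hL : ∀ S ∈ L, S.height ≤ 1) :
    ∀ C ∈ nextFit L, (C.map HarmonicShelf.height).sum ≤ 1 := by
  cases L with
  | nil => simp [nextFit]
  | cons S L =>
    rw [List.forall_mem_cons] at hL
    exact sum_height_le_one_of_mem_nextFitFrom (by simpa using hL.1) hL.2

/-- A bin is closed only when its content and the next shelf together exceed `1`. In the sum of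
these inequalities each shelf counts at most twice, once within its bin and once as the opener of
it; the shelves already in `B` count once. -/
theorem length_nextFitFrom {B L : List (HarmonicShelf ι m)} (hL : ∀ S ∈ L, 0 ≤ S.height) :
    (nextFitFrom B L).length = 1 ∨ ((nextFitFrom B L).length : ℝ) - 1 <
      (B.map HarmonicShelf.height).sum + 2 * (L.map HarmonicShelf.height).sum := by
  induction L generalizing B with
  | nil => simp [nextFitFrom]
  | cons S L ih =>
    rw [List.forall_mem_cons] at hL
    have hs : 0 ≤ (L.map HarmonicShelf.height).sum := by
      refine List.sum_nonneg fun x hx => ?_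
      obtain ⟨S', hS', rfl⟩ := List.mem_map.1 hx
      exact hL.2 S' hS'
    rw [nextFitFrom]
    split_ifs with h
    · refine (ih (B := B ++ [S]) hL.2).imp_right fun h' => ?_
      simp only [List.map_append, List.sum_append, List.map_cons, List.map_nil, List.sum_cons,
        List.sum_nil] at h' ⊢
      linarith [hL.1]
    · right
      have h' := ih (B := [S]) hL.2
      simp only [List.map_cons, List.map_nil, List.sum_cons, List.sum_nil, List.length_cons] at h' ⊢
      push_cast
      rcases h' with h' | h'
      · rw [h']
        push_cast
        linarith [hL.1]
      · linarith [hL.1]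

/-- Next-Fit uses at most `2n` bins for shelves of total height at most `n`, for `n > 0`. -/
theorem length_nextFit_le {L : List (HarmonicShelf ι m)} (hL : ∀ S ∈ L, 0 ≤ S.height) {n : ℕ}
    (hn : 0 < n) (hs : (L.map HarmonicShelf.height).sum ≤ n) : (nextFit L).length ≤ 2 * n := by
  cases L with
  | nil => simp [nextFit]
  | cons S L =>
    rw [List.forall_mem_cons] at hL
    rw [List.map_cons, List.sum_cons] at hs
    rw [nextFit]
    rcases length_nextFitFrom (B := [S]) hL.2 with h | h
    · omega
    · simp only [List.map_cons, List.map_nil, List.sum_cons, List.sum_nil] at h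
      have : ((nextFitFrom [S] L).length : ℝ) < 2 * n + 1 := by linarith [hL.1]
      exact Nat.lt_succ_iff.1 (by exact_mod_cast this)

end NextFit

/-! ### HDH-NF -/

section HdhNF

variable {m : ℕ} {len : ι → Fin (m + 2) → ℝ} {I : List ι}

/-- The base types that occur in a list of items, each listed once. -/
def baseTypes (len : ι → Fin (m + 2) → ℝ) (I : List ι) : List (Fin (m + 1) → ℕ) :=
  (I.map (baseType 3 len)).dedup

theorem flatMap_filter_baseType_perm (len : ι → Fin (m + 2) → ℝ) (hI : I.Nodup) :
    ((baseTypes len I).flatMap fun t => I.filter fun i => decide (baseType 3 len i = t)).Perm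
      I := by
  refine (List.perm_ext_iff_of_nodup (List.nodup_flatMap.2 ⟨fun t _ => hI.filter _, ?_⟩) hI).2 ?_
  · refine (List.nodup_dedup _).imp fun {t t'} hne i hi hi' => hne ?_
    simp only [List.mem_filter, decide_eq_true_eq] at hi hi'
    exact hi.2.symm.trans hi'.2
  · intro i
    simp only [baseTypes, List.mem_flatMap, List.mem_dedup, List.mem_map, List.mem_filter,
      decide_eq_true_eq]
    exact ⟨fun ⟨_, _, h, _⟩ => h, fun h => ⟨_, ⟨i, h, rfl⟩, h, rfl⟩⟩

theorem length_baseTypes_le (hbox : ∀ i ∈ I, IsBox (len i)) :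
    (baseTypes len I).length ≤ 3 ^ (m + 1) := by
  rw [baseTypes, ← List.card_toFinset]
  calc (I.map (baseType 3 len)).toFinset.card
      ≤ (Fintype.piFinset fun _ : Fin (m + 1) => ({1, 2, 3} : Finset ℕ)).card := by
        refine Finset.card_le_card fun t ht => ?_
        obtain ⟨i, hi, rfl⟩ := List.mem_map.1 (List.mem_toFinset.1 ht)
        refine Fintype.mem_piFinset.2 fun j => ?_
        have h := (hbox i hi).baseLen j
        rcases harmonic_three_cases h.1 h.2 with h | h | h <;> simp [baseType, h.1]
    _ = 3 ^ (m + 1) := by simp [Fintype.card_piFinset]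

variable [DecidableEq ι]

theorem flatMap_items_hdhShelves_perm (len : ι → Fin (m + 2) → ℝ) (I : List ι)
    (t : Fin (m + 1) → ℕ) :
    ((hdhShelves 3 len I t).flatMap HarmonicShelf.items).Perm
      (I.filter fun i => decide (baseType 3 len i = t)) := by
  rw [hdhShelves, List.flatMap_map, List.flatMap_id', cutGroups_flatten]
  exact sortByHeight_perm _

theorem isPacked_of_mem_hdhShelves (hbox : ∀ i ∈ I, IsBox (len i)) {t : Fin (m + 1) → ℕ}
    {S : HarmonicShelf ι (m + 1)} (hS : S ∈ hdhShelves 3 len I t) :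
    S.IsPacked len ∧ S.height ≤ 1 := by
  obtain ⟨J, hJ, rfl⟩ := List.mem_map.1 hS
  have hmem : ∀ i ∈ J, i ∈ I ∧ baseType 3 len i = t := fun i hi => by
    simpa using (sortByHeight_perm _).mem_iff.1 (mem_of_mem_cutGroups hJ hi)
  refine ⟨⟨?_, le_maxHeight, maxHeight_nonneg J⟩,
    maxHeight_le zero_le_one fun i hi => (hbox i (hmem i hi).1 _).2⟩
  exact isSeparated_hdhUnitPack m _ t J (fun i hi => (hbox i (hmem i hi).1).baseLen)
    (fun i hi j => congrFun (hmem i hi).2 j) (sum_dropLast_lt_of_mem_cutGroups _ J hJ)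

theorem sum_tail_hdhShelves_le (hbox : ∀ i ∈ I, IsBox (len i)) (t : Fin (m + 1) → ℕ) :
    (((hdhShelves 3 len I t).tail).map HarmonicShelf.height).sum ≤
      ((I.filter fun i => decide (baseType 3 len i = t)).map fun i =>
        baseWeight 3 len i * len i (Fin.last _)).sum := by
  set l := I.filter fun i => decide (baseType 3 len i = t) with hl
  have hperm := sortByHeight_perm (len := len) l
  have hb : ∀ i ∈ sortByHeight len l, IsBox (len i) := fun i hi =>
    hbox i (List.mem_of_mem_filter (hperm.mem_iff.1 hi))
  have := sum_tail_maxHeight_le (len := len) (w := baseWeight 3 len) (sortByHeight len l)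
    (fun i hi => (hb i hi).baseLen.harmonicWeight_nonneg) (fun i hi => (hb i hi _).1.le)
    (sortByHeight_pairwise l)
  rw [(hperm.map _).sum_eq] at this
  rw [List.map_tail, hdhShelves, List.map_map]
  exact this

/-- The bins of HDH-NF, as stacks of shelves. -/
def hdhStacks (len : ι → Fin (m + 2) → ℝ) (I : List ι) :
    List (List (HarmonicShelf ι (m + 1))) :=
  ((((baseTypes len I).map (hdhShelves 3 len I)).filterMap List.head?).map fun S => [S]) ++
    nextFit (((baseTypes len I).map (hdhShelves 3 len I)).flatMap List.tail)

theorem hdhNF_eq_map (len : ι → Fin (m + 2) → ℝ) (I : List ι) :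
    hdhNF 3 len I = (hdhStacks len I).map stackBin := rfl

theorem filterMap_head?_append_flatMap_tail_perm {α : Type*} (L : List (List α)) :
    (L.filterMap List.head? ++ L.flatMap List.tail).Perm L.flatten := by
  induction L with
  | nil => simp
  | cons l L ih =>
    cases l with
    | nil => simpa [List.filterMap_cons] using ih
    | cons a l =>
      simp only [List.filterMap_cons, List.head?_cons, List.flatMap_cons, List.tail_cons,
        List.flatten_cons, List.cons_append, List.perm_cons]
      refine List.Perm.trans ?_ (ih.append_left l)
      rw [← List.append_assoc, ← List.append_assoc]
      exact List.perm_append_comm.append_right _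

theorem hdhStacks_flatten_perm (len : ι → Fin (m + 2) → ℝ) (I : List ι) :
    (hdhStacks len I).flatten.Perm ((baseTypes len I).map (hdhShelves 3 len I)).flatten := by
  rw [hdhStacks, List.flatten_append, nextFit_flatten, ← List.flatMap_def,
    List.flatMap_singleton']
  exact filterMap_head?_append_flatMap_tail_perm _

/-- Following the items as a list up to permutation yields at once that the bins cover everything
and, since `I` has no duplicates, that they are disjoint. -/
theorem hdhStacks_items_perm (len : ι → Fin (m + 2) → ℝ) (hI : I.Nodup) :
    ((hdhStacks len I).flatMap fun B => B.flatMap HarmonicShelf.items).Perm I := by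
  rw [← List.flatMap_assoc, List.flatMap_id']
  refine ((hdhStacks_flatten_perm len I).flatMap_right _).trans ?_
  rw [← List.flatMap_def, List.flatMap_assoc]
  exact (List.Perm.flatMap_left _ fun t _ => flatMap_items_hdhShelves_perm len I t).trans
    (flatMap_filter_baseType_perm len hI)

theorem isPacked_of_mem_hdhStacks (hbox : ∀ i ∈ I, IsBox (len i))
    {B : List (HarmonicShelf ι (m + 1))} (hB : B ∈ hdhStacks len I)
    {S : HarmonicShelf ι (m + 1)} (hS : S ∈ B) : S.IsPacked len ∧ S.height ≤ 1 := by
  have h := (hdhStacks_flatten_perm len I).mem_iff.1 (List.mem_flatten.2 ⟨B, hB, hS⟩)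
  rw [← List.flatMap_def] at h
  obtain ⟨t, -, ht⟩ := List.mem_flatMap.1 h
  exact isPacked_of_mem_hdhShelves hbox ht

theorem isPacked_of_mem_tails (hbox : ∀ i ∈ I, IsBox (len i)) {S : HarmonicShelf ι (m + 1)}
    (hS : S ∈ ((baseTypes len I).map (hdhShelves 3 len I)).flatMap List.tail) :
    S.IsPacked len ∧ S.height ≤ 1 := by
  rw [List.flatMap_map] at hS
  obtain ⟨t, -, ht⟩ := List.mem_flatMap.1 hS
  exact isPacked_of_mem_hdhShelves hbox (List.mem_of_mem_tail ht)

theorem sum_height_le_one_of_mem_hdhStacks (hbox : ∀ i ∈ I, IsBox (len i))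
    {B : List (HarmonicShelf ι (m + 1))} (hB : B ∈ hdhStacks len I) :
    (B.map HarmonicShelf.height).sum ≤ 1 := by
  rcases List.mem_append.1 hB with h | h
  · obtain ⟨S, -, rfl⟩ := List.mem_map.1 h
    simpa using (isPacked_of_mem_hdhStacks hbox hB (List.mem_singleton_self S)).2
  · exact sum_height_le_one_of_mem_nextFit (fun S hS => (isPacked_of_mem_tails hbox hS).2) B h

theorem hdhNF_isBinPacking {J : Finset ι} (hbox : ∀ i ∈ J, IsBox (len i)) :
    IsBinPacking len J (hdhNF 3 len J.toList) := by
  have hbox' : ∀ i ∈ J.toList, IsBox (len i) := fun i hi => hbox i (Finset.mem_toList.1 hi)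
  have hperm := hdhStacks_items_perm len J.nodup_toList
  have hitems : ∀ (B : List (HarmonicShelf ι (m + 1))) (i : ι),
      i ∈ (stackBin B).items ↔ i ∈ B.flatMap HarmonicShelf.items := fun B i =>
    List.mem_toFinset
  refine ⟨?_, ?_, ?_⟩
  · intro C hC
    rw [hdhNF_eq_map] at hC
    obtain ⟨B, hB, rfl⟩ := List.mem_map.1 hC
    have h := isSeparated_stackPos (fun S hS => (isPacked_of_mem_hdhStacks hbox' hB hS).1)
      (sum_height_le_one_of_mem_hdhStacks hbox' hB)
    refine IsSeparated.isPacking ⟨fun i hi => h.1 i ((hitems B i).1 hi), fun i hi i' hi' =>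
      h.2 i ((hitems B i).1 hi) i' ((hitems B i').1 hi')⟩
  · rw [hdhNF_eq_map, List.pairwise_map]
    refine (List.nodup_flatMap.1 (hperm.nodup_iff.2 J.nodup_toList)).2.imp fun {B B'} h => ?_
    exact Finset.disjoint_left.2 fun i hi hi' => h ((hitems B i).1 hi) ((hitems B' i).1 hi')
  · intro i
    rw [← Finset.mem_toList, ← hperm.mem_iff, hdhNF_eq_map, List.mem_flatMap]
    simp [stackBin]

/-- With `d = m + 2`, at most `3 ^ (d - 1)` bins hold first shelves, one per base type, and Next-Fit
opens at most `2 * 3 ^ (d - 1)` for the rest. -/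
theorem hdhNF_length_le (hI : I.Nodup) (hbox : ∀ i ∈ I, IsBox (len i))
    (hsum : (I.map fun i => baseWeight 3 len i * len i (Fin.last _)).sum ≤ 3 ^ (m + 1)) :
    (hdhNF 3 len I).length ≤ 3 ^ (m + 2) := by
  rw [hdhNF_eq_map, List.length_map, hdhStacks, List.length_append, List.length_map]
  have h1 : (((baseTypes len I).map (hdhShelves 3 len I)).filterMap List.head?).length ≤
      3 ^ (m + 1) :=
    (List.length_filterMap_le _ _).trans (by simpa using length_baseTypes_le hbox)
  have h2 := length_nextFit_le
    (L := ((baseTypes len I).map (hdhShelves 3 len I)).flatMap List.tail)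
    (fun S hS => (isPacked_of_mem_tails hbox hS).1.height_nonneg) (n := 3 ^ (m + 1))
    (by positivity) (by
      push_cast
      refine le_trans ?_ hsum
      rw [← ((flatMap_filter_baseType_perm len hI).map _).sum_eq, List.flatMap_map,
        List.map_flatMap, List.map_flatMap, List.flatMap_def, List.flatMap_def, List.sum_flatten,
        List.sum_flatten, List.map_map, List.map_map]
      exact List.sum_le_sum fun t _ => sum_tail_hdhShelves_le hbox t)
  rw [pow_succ 3 (m + 1)]
  omega

end HdhNF

/-! ### Choices -/

section Choice

variable [DecidableEq ι] {itemsets : Finset (Finset ι)} {S : Finset ι}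

theorem IsChoice.mono {S' : Finset ι} (h : IsChoice itemsets S) (hS : S' ⊆ S) :
    IsChoice itemsets S' :=
  ⟨hS.trans h.1, fun I hI =>
    (Finset.card_le_card (Finset.inter_subset_inter_right hS)).trans (h.2 I hI)⟩

theorem isChoice_empty : IsChoice itemsets ∅ := ⟨by simp, by simp⟩

theorem IsChoice.card_le (h : IsChoice itemsets S) : S.card ≤ itemsets.card := by
  have hS : S = itemsets.biUnion fun I => S ∩ I := by
    rw [← Finset.inter_biUnion]
    exact (Finset.inter_eq_left.2 h.1).symm
  rw [hS]
  exact (Finset.card_biUnion_le_card_mul _ _ 1 fun I hI => h.2 I hI).trans (by simp)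

/-- Adding an item of an itemset that is not yet used preserves the choice constraint. -/
theorem IsChoice.insert (hdis : ∀ I ∈ itemsets, ∀ I' ∈ itemsets, I ≠ I' → Disjoint I I')
    (h : IsChoice itemsets S) {I : Finset ι} (hI : I ∈ itemsets) {i : ι} (hi : i ∈ I)
    (hS : S ∩ I = ∅) : IsChoice itemsets (insert i S) := by
  refine ⟨Finset.insert_subset (Finset.mem_biUnion.2 ⟨I, hI, hi⟩) h.1, fun I' hI' => ?_⟩
  by_cases hne : I = I'
  · subst hne
    rw [Finset.insert_inter_of_mem hi, hS]
    simp
  · rw [Finset.insert_inter_of_notMem (Finset.disjoint_left.1 (hdis I hI I' hI' hne) hi)]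
    exact h.2 I' hI'

end Choice

/-! ### Lawler's approximation scheme -/

namespace MCKS1

/-- The standing assumptions on a one-dimensional instance: different itemsets share no item, every
item fits into the knapsack, sizes and profits are nonnegative. -/
structure IsValid (P : MCKS1 ι) : Prop where
  disjoint : ∀ I ∈ P.itemsets, ∀ I' ∈ P.itemsets, I ≠ I' → Disjoint I I'
  size_nonneg : ∀ I ∈ P.itemsets, ∀ i ∈ I, 0 ≤ P.size i
  size_le_one : ∀ I ∈ P.itemsets, ∀ i ∈ I, P.size i ≤ 1
  profit_nonneg : ∀ I ∈ P.itemsets, ∀ i ∈ I, 0 ≤ P.profit i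

variable {P : MCKS1 ι} {ε : ℝ}

theorem mem_allItems {c : Finset ι × ι} : c ∈ P.allItems ↔ c.1 ∈ P.itemsets ∧ c.2 ∈ c.1 := by
  obtain ⟨I, i⟩ := c
  simp only [allItems, List.mem_flatMap, Finset.mem_toList, List.mem_map, Prod.mk.injEq]
  constructor
  · rintro ⟨I', hI', i', hi', rfl, rfl⟩
    exact ⟨hI', hi'⟩
  · rintro ⟨hI, hi⟩
    exact ⟨I, hI, i, hi, rfl, rfl⟩

variable [DecidableEq ι]

theorem IsValid.profit_nonneg_of_isChoice (hP : P.IsValid) {S : Finset ι}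
    (hS : IsChoice P.itemsets S) {i : ι} (hi : i ∈ S) : 0 ≤ P.profit i := by
  obtain ⟨I, hI, hiI⟩ := Finset.mem_biUnion.1 (hS.1 hi)
  exact hP.profit_nonneg I hI i hiI

theorem IsValid.isFeasible_mono (hP : P.IsValid) {S S' : Finset ι} (hS : P.IsFeasible S)
    (h : S' ⊆ S) : P.IsFeasible S' := by
  refine ⟨hS.1.mono h, (Finset.sum_le_sum_of_subset_of_nonneg h fun i hi _ => ?_).trans hS.2⟩
  obtain ⟨I, hI, hiI⟩ := Finset.mem_biUnion.1 (hS.1.1 hi)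
  exact hP.size_nonneg I hI i hiI

theorem isFeasible_empty : P.IsFeasible ∅ := ⟨isChoice_empty, by simp [totalSize]⟩

theorem IsValid.isFeasible_singleton (hP : P.IsValid) {I : Finset ι} (hI : I ∈ P.itemsets) {i : ι}
    (hi : i ∈ I) : P.IsFeasible {i} := by
  refine ⟨?_, by simpa [totalSize] using hP.size_le_one I hI i hi⟩
  simpa using (isChoice_empty (itemsets := P.itemsets)).insert hP.disjoint hI hi (by simp)

theorem IsValid.greedy_isFeasible (hP : P.IsValid) (t : ℕ) {S : Finset ι} (hS : P.IsFeasible S) :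
    P.IsFeasible (P.greedy t S) := by
  induction t generalizing S with
  | zero => exact hS
  | succ t ih =>
    rw [greedy]
    split
    · exact hS
    · rename_i c hc
      split_ifs with hle
      · refine ih ⟨?_, hle⟩
        have hmem := mem_allItems.1 (List.mem_of_mem_filter (List.argmax_mem hc))
        exact (hS.1.mono Finset.sdiff_subset).insert hP.disjoint hmem.1 hmem.2 (by simp)
      · exact hS

theorem le_foldr_max (l : List ℝ) : 0 ≤ l.foldr max 0 ∧ ∀ x ∈ l, x ≤ l.foldr max 0 := by
  induction l with
  | nil => simp
  | cons a l ih =>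
    rw [List.foldr_cons, List.forall_mem_cons]
    exact ⟨le_max_of_le_right ih.1, le_max_left _ _, fun x hx => le_max_of_le_right (ih.2 x hx)⟩

theorem foldr_max_le {l : List ℝ} {c : ℝ} (hc : 0 ≤ c) (h : ∀ x ∈ l, x ≤ c) :
    l.foldr max 0 ≤ c := by
  induction l with
  | nil => simpa using hc
  | cons a l ih =>
    rw [List.forall_mem_cons] at h
    exact max_le h.1 (ih h.2)

theorem lowerBound_nonneg : 0 ≤ P.lowerBound := le_max_of_le_left (le_foldr_max _).1

theorem profit_le_lowerBound {I : Finset ι} (hI : I ∈ P.itemsets) {i : ι} (hi : i ∈ I) :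
    P.profit i ≤ P.lowerBound :=
  le_max_of_le_left ((le_foldr_max _).2 _
    (List.mem_map.2 ⟨(I, i), mem_allItems.2 ⟨hI, hi⟩, rfl⟩))

/-- `P₀` comes from feasible solutions: the empty set, single items and the greedy set. Nothing
about the quality of the greedy set is needed. -/
theorem IsValid.lowerBound_le (hP : P.IsValid) {c : ℝ}
    (hc : ∀ S, P.IsFeasible S → P.totalProfit S ≤ c) : P.lowerBound ≤ c := by
  refine max_le (foldr_max_le ?_ fun x hx => ?_) (hc _ (hP.greedy_isFeasible _ isFeasible_empty))
  · simpa [totalProfit] using hc ∅ isFeasible_empty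
  · obtain ⟨c', hc', rfl⟩ := List.mem_map.1 hx
    obtain ⟨hI, hi⟩ := mem_allItems.1 hc'
    simpa [totalProfit] using hc _ (hP.isFeasible_singleton hI hi)

theorem Dominates.refl (S : Finset ι) : P.Dominates ε S S := ⟨le_rfl, le_rfl⟩

theorem Dominates.trans {S S' S'' : Finset ι} (h : P.Dominates ε S S')
    (h' : P.Dominates ε S' S'') : P.Dominates ε S S'' := ⟨h'.1.trans h.1, h.2.trans h'.2⟩

/-- The new item lies in neither set, so it adds the same amount to both sides of each comparison.
-/
theorem Dominates.insert {S S' : Finset ι} (h : P.Dominates ε S S') {i : ι} (hi : i ∉ S)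
    (hi' : i ∉ S') : P.Dominates ε (insert i S) (insert i S') := by
  obtain ⟨h1, h2⟩ := h
  rw [scaledProfit, scaledProfit] at h1
  rw [totalSize, totalSize] at h2
  rw [Dominates, scaledProfit, scaledProfit, totalSize, totalSize, Finset.sum_insert hi,
    Finset.sum_insert hi', Finset.sum_insert hi, Finset.sum_insert hi']
  exact ⟨by omega, by linarith⟩

theorem mem_insertState {L : List (Finset ι)} {S S' : Finset ι}
    (h : S' ∈ P.insertState ε L S) : S' ∈ L ∨ S' = S ∧ P.totalSize S ≤ 1 := by
  rw [insertState] at h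
  split_ifs at h with hif
  · exact Or.inl h
  · rcases List.mem_cons.1 h with rfl | h
    · exact Or.inr ⟨rfl, not_lt.1 fun hlt => hif (Or.inl hlt)⟩
    · exact Or.inl (List.mem_of_mem_filter h)

theorem exists_dominates_insertState_of_mem {L : List (Finset ι)} (S : Finset ι) {S' : Finset ι}
    (h : S' ∈ L) : ∃ T ∈ P.insertState ε L S, P.Dominates ε T S' := by
  rw [insertState]
  split_ifs
  · exact ⟨S', h, Dominates.refl S'⟩
  · by_cases hd : P.Dominates ε S S'
    · exact ⟨S, List.mem_cons_self, hd⟩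
    · exact ⟨S', List.mem_cons_of_mem _ (List.mem_filter.2 ⟨h, by simpa using hd⟩),
        Dominates.refl S'⟩

theorem exists_dominates_insertState (L : List (Finset ι)) {S : Finset ι}
    (hS : P.totalSize S ≤ 1) : ∃ T ∈ P.insertState ε L S, P.Dominates ε T S := by
  rw [insertState]
  split_ifs with hif
  · exact hif.resolve_left (not_lt.2 hS)
  · exact ⟨S, List.mem_cons_self, Dominates.refl S⟩

theorem mem_foldl_insertState {C L : List (Finset ι)} {S : Finset ι}
    (h : S ∈ C.foldl (P.insertState ε) L) : S ∈ L ∨ S ∈ C ∧ P.totalSize S ≤ 1 := by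
  induction C generalizing L with
  | nil => exact Or.inl h
  | cons T C ih =>
    rcases ih h with h | h
    · rcases mem_insertState h with h | ⟨rfl, h⟩
      · exact Or.inl h
      · exact Or.inr ⟨List.mem_cons_self, h⟩
    · exact Or.inr ⟨List.mem_cons_of_mem _ h.1, h.2⟩

/-- A state of size at most `1` is discarded only in favour of a dominating one; by transitivity
some dominating state survives all later insertions. -/
theorem exists_dominates_foldl_insertState {C L : List (Finset ι)} {S : Finset ι}
    (h : S ∈ L ∨ S ∈ C ∧ P.totalSize S ≤ 1) :
    ∃ T ∈ C.foldl (P.insertState ε) L, P.Dominates ε T S := by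
  induction C generalizing L S with
  | nil =>
    exact ⟨S, by simpa using h, Dominates.refl S⟩
  | cons U C ih =>
    have key : (∃ T ∈ P.insertState ε L U, P.Dominates ε T S) ∨ S ∈ C ∧ P.totalSize S ≤ 1 := by
      rcases h with h | ⟨h, hs⟩
      · exact Or.inl (exists_dominates_insertState_of_mem U h)
      · rcases List.mem_cons.1 h with rfl | h
        · exact Or.inl (exists_dominates_insertState L hs)
        · exact Or.inr ⟨h, hs⟩
    rcases key with ⟨T, hT, hd⟩ | h
    · obtain ⟨T', hT', hd'⟩ := ih (Or.inl hT)
      exact ⟨T', hT', hd'.trans hd⟩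
    · exact ih (Or.inr h)

theorem mem_stage {L : List (Finset ι)} {I S : Finset ι} (h : S ∈ P.stage ε L I) :
    P.totalSize S ≤ 1 ∧ (S ∈ L ∨ ∃ S' ∈ L, ∃ i ∈ I, S = insert i S') := by
  rcases mem_foldl_insertState h with h | ⟨h, hs⟩
  · simp at h
  · refine ⟨hs, (List.mem_append.1 h).imp_right fun h => ?_⟩
    obtain ⟨S', hS', h⟩ := List.mem_flatMap.1 h
    obtain ⟨i, hi, rfl⟩ := List.mem_map.1 h
    exact ⟨S', hS', i, Finset.mem_toList.1 hi, rfl⟩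

theorem exists_dominates_stage {L : List (Finset ι)} {I S : Finset ι} (hs : P.totalSize S ≤ 1)
    (h : S ∈ L ∨ ∃ S' ∈ L, ∃ i ∈ I, S = insert i S') :
    ∃ T ∈ P.stage ε L I, P.Dominates ε T S := by
  refine exists_dominates_foldl_insertState (Or.inr ⟨List.mem_append.2 (h.imp_right ?_), hs⟩)
  rintro ⟨S', hS', i, hi, rfl⟩
  exact List.mem_flatMap.2 ⟨S', hS', List.mem_map.2 ⟨i, Finset.mem_toList.2 hi, rfl⟩⟩

/-- `L` is a correct table for the itemsets `Q`: all its states are feasible and use these itemsets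
only, and each such solution is dominated by one of them. -/
def IsTable (P : MCKS1 ι) (ε : ℝ) (Q : Finset (Finset ι)) (L : List (Finset ι)) : Prop :=
  (∀ S ∈ L, P.IsFeasible S ∧ S ⊆ Q.biUnion id) ∧
    ∀ S, P.IsFeasible S → S ⊆ Q.biUnion id → ∃ T ∈ L, P.Dominates ε T S

theorem IsValid.isTable_stage (hP : P.IsValid) {Q : Finset (Finset ι)} {L : List (Finset ι)}
    (hL : P.IsTable ε Q L) (hQ : Q ⊆ P.itemsets) {I : Finset ι} (hI : I ∈ P.itemsets)
    (hIQ : I ∉ Q) : P.IsTable ε (insert I Q) (P.stage ε L I) := by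
  have hdis : ∀ S ⊆ Q.biUnion id, ∀ i ∈ I, i ∉ S := by
    intro S hS i hi hiS
    obtain ⟨I', hI', hi'⟩ := Finset.mem_biUnion.1 (hS hiS)
    exact Finset.disjoint_left.1 (hP.disjoint I hI I' (hQ hI') fun h => hIQ (h ▸ hI')) hi hi'
  rw [IsTable, Finset.biUnion_insert]
  refine ⟨fun S hS => ?_, fun S hS hSQ => ?_⟩
  · obtain ⟨hs, hS | ⟨S', hS', i, hi, rfl⟩⟩ := mem_stage hS
    · exact ⟨(hL.1 S hS).1, (hL.1 S hS).2.trans Finset.subset_union_right⟩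
    · obtain ⟨hf, hsub⟩ := hL.1 S' hS'
      refine ⟨⟨hf.1.insert hP.disjoint hI hi ?_, hs⟩, ?_⟩
      · exact Finset.disjoint_iff_inter_eq_empty.1
          (Finset.disjoint_right.2 fun i hi => hdis S' hsub i hi)
      · exact Finset.insert_subset (Finset.mem_union_left _ hi)
          (hsub.trans Finset.subset_union_right)
  · rcases (S ∩ I).eq_empty_or_nonempty with he | ⟨i, hi⟩
    · have hSQ' : S ⊆ Q.biUnion id := fun i hi => by
        refine (Finset.mem_union.1 (hSQ hi)).resolve_left fun hiI => ?_
        exact Finset.notMem_empty i (he ▸ Finset.mem_inter.2 ⟨hi, hiI⟩)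
      obtain ⟨T, hT, hd⟩ := hL.2 S hS hSQ'
      obtain ⟨T', hT', hd'⟩ := exists_dominates_stage (P := P) (ε := ε) (I := I)
        (hd.2.trans hS.2) (Or.inl hT)
      exact ⟨T', hT', hd'.trans hd⟩
    · obtain ⟨hiS, hiI⟩ := Finset.mem_inter.1 hi
      have hSQ' : S.erase i ⊆ Q.biUnion id := fun j hj => by
        obtain ⟨hji, hjS⟩ := Finset.mem_erase.1 hj
        refine (Finset.mem_union.1 (hSQ hjS)).resolve_left fun hjI => hji ?_
        exact Finset.card_le_one.1 (hS.1.2 I hI) j (Finset.mem_inter.2 ⟨hjS, hjI⟩) i hi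
      obtain ⟨T, hT, hd⟩ := hL.2 _ (hP.isFeasible_mono hS (Finset.erase_subset i S)) hSQ'
      -- Exchange argument: `S` without its item `i` of `I` is dominated by a state `T` of the old
      -- table, and putting `i` back keeps dominance. The result is no larger than `S`, so it passes
      -- the capacity test.
      have hd2 := hd.insert (hdis T (hL.1 T hT).2 i hiI) (Finset.notMem_erase i S)
      rw [Finset.insert_erase hiS] at hd2
      obtain ⟨T', hT', hd'⟩ := exists_dominates_stage (P := P) (ε := ε) (I := I)
        (hd2.2.trans hS.2) (Or.inr ⟨T, hT, i, hiI, rfl⟩)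
      exact ⟨T', hT', hd'.trans hd2⟩

theorem IsValid.isTable_foldl (hP : P.IsValid) (l : List (Finset ι)) {Q : Finset (Finset ι)}
    {L : List (Finset ι)} (hL : P.IsTable ε Q L) (hQ : Q ⊆ P.itemsets)
    (hl : ∀ I ∈ l, I ∈ P.itemsets ∧ I ∉ Q) (hnd : l.Nodup) :
    P.IsTable ε (Q ∪ l.toFinset) (l.foldl (P.stage ε) L) := by
  induction l generalizing Q L with
  | nil => simpa using hL
  | cons I l ih =>
    rw [List.forall_mem_cons] at hl
    rw [List.nodup_cons] at hnd
    have := ih (hP.isTable_stage hL hQ hl.1.1 hl.1.2) (Finset.insert_subset hl.1.1 hQ)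
      (fun I' hI' => ⟨(hl.2 I' hI').1, fun h => ?_⟩) hnd.2
    · rwa [List.toFinset_cons, Finset.union_insert, ← Finset.insert_union]
    · rcases Finset.mem_insert.1 h with rfl | h
      · exact hnd.1 hI'
      · exact (hl.2 I' hI').2 h

/-- The dynamic program solves the scaled problem exactly. -/
theorem IsValid.lawler_isOptimal_scaled (hP : P.IsValid) :
    P.IsFeasible (P.lawler ε) ∧
      ∀ S, P.IsFeasible S → P.scaledProfit ε S ≤ P.scaledProfit ε (P.lawler ε) := by
  have h0 : P.IsTable ε ∅ [∅] := by
    refine ⟨by simpa using isFeasible_empty, fun S _ hS => ⟨∅, by simp, ?_⟩⟩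
    have : S = ∅ := by simpa using hS
    exact this ▸ Dominates.refl _
  have h := hP.isTable_foldl P.itemsets.toList h0 (by simp) (by simp) P.itemsets.nodup_toList
  rw [Finset.empty_union, Finset.toList_toFinset] at h
  rw [lawler]
  set L := P.itemsets.toList.foldl (P.stage ε) [∅]
  -- The table is nonempty, as it dominates `∅`, so the default value of `getD` is never taken.
  obtain ⟨T₀, hT₀, -⟩ := h.2 ∅ isFeasible_empty (by simp)
  obtain ⟨T, hT⟩ := Option.ne_none_iff_exists'.1 fun hnone : L.argmax (P.scaledProfit ε) = none =>
    List.not_mem_nil (List.argmax_eq_none.1 hnone ▸ hT₀)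
  rw [hT, Option.getD_some]
  refine ⟨(h.1 T (List.argmax_mem hT)).1, fun S hS => ?_⟩
  obtain ⟨T', hT', hd⟩ := h.2 S hS hS.1.1
  exact hd.1.trans (List.le_of_mem_argmax hT' hT)

theorem IsValid.lawler_isApproxSolution (hP : P.IsValid) (hε : 0 < ε) (hε1 : ε ≤ 1) :
    P.IsApproxSolution (1 - ε) (P.lawler ε) := by
  obtain ⟨hfeas, hopt⟩ := hP.lawler_isOptimal_scaled (ε := ε)
  refine ⟨hfeas, ?_⟩
  set T := P.lawler ε
  have hTnn : 0 ≤ P.totalProfit T :=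
    Finset.sum_nonneg fun i hi => hP.profit_nonneg_of_isChoice hfeas.1 hi
  have hLB : 0 ≤ ε * P.lowerBound := mul_nonneg hε.le lowerBound_nonneg
  have hKnn : 0 ≤ P.scale ε := div_nonneg hLB (Nat.cast_nonneg _)
  have key : ∀ S, P.IsFeasible S → P.totalProfit S ≤ P.totalProfit T + ε * P.lowerBound := by
    intro S hS
    rcases hKnn.eq_or_lt with hK | hK
    · suffices P.totalProfit S ≤ 0 by linarith
      refine Finset.sum_nonpos fun i hi => ?_
      obtain ⟨I, hI, hiI⟩ := Finset.mem_biUnion.1 (hS.1.1 hi)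
      refine (profit_le_lowerBound hI hiI).trans (le_of_eq ?_)
      have hn : (P.itemsets.card : ℝ) ≠ 0 :=
        Nat.cast_ne_zero.2 (Finset.card_ne_zero_of_mem hI)
      have h0 := (div_eq_zero_iff.1 hK.symm).resolve_right hn
      exact (mul_eq_zero.1 h0).resolve_left hε.ne'
    · have hn : (P.itemsets.card : ℝ) ≠ 0 := fun h => hK.ne' (by rw [scale, h, div_zero])
      have hKn : P.scale ε * P.itemsets.card = ε * P.lowerBound := div_mul_cancel₀ _ hn
      have hcard : (S.card : ℝ) ≤ P.itemsets.card := Nat.cast_le.2 hS.1.card_le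
      have hST : (P.scaledProfit ε S : ℝ) ≤ P.scaledProfit ε T := Nat.cast_le.2 (hopt S hS)
      -- Rounding down loses at most `K` per item, and a choice has at most `n` items; altogether
      -- this is at most `K n = ε P₀`.
      have h1 : P.totalProfit S ≤ P.scale ε * (P.scaledProfit ε S + S.card) := by
        rw [totalProfit, scaledProfit, Nat.cast_sum, Finset.card_eq_sum_ones, Nat.cast_sum,
          ← Finset.sum_add_distrib, Finset.mul_sum]
        refine Finset.sum_le_sum fun i _ => ?_
        rw [mul_comm, ← div_le_iff₀ hK, Nat.cast_one]
        exact (Nat.lt_floor_add_one _).le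
      have h2 : P.scale ε * P.scaledProfit ε T ≤ P.totalProfit T := by
        rw [totalProfit, scaledProfit, Nat.cast_sum, Finset.mul_sum]
        refine Finset.sum_le_sum fun i hi => ?_
        rw [mul_comm, ← le_div_iff₀ hK]
        exact Nat.floor_le (div_nonneg (hP.profit_nonneg_of_isChoice hfeas.1 hi) hK.le)
      nlinarith
  intro S hS
  -- Applying `key` to the solutions behind `P₀` gives `(1 - ε) P₀ ≤ p(T)`. Hence `(1 - ε) p(S) ≤ (1
  -- - ε) p(T) + ε (1 - ε) P₀ ≤ p(T)`, without reference to an optimal solution.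
  have hle := hP.lowerBound_le key
  nlinarith [key S hS]

end MCKS1

/-! ### The reduction to dimension one -/

section Reduction

variable {m : ℕ}

/-- Each of the `m` base dimensions contributes one factor `1 / T = 1/3`. Capacity `1` therefore
means total base weight times height at most `3 ^ m`. -/
theorem cuboidVol_mapBase_harmonicH (len : ι → Fin (m + 1) → ℝ) (i : ι) :
    cuboidVol (mapBase (harmonicH 3) (len i)) =
      baseWeight 3 len i * len i (Fin.last m) / 3 ^ m := by
  rw [cuboidVol, Fin.prod_univ_castSucc, mul_div_right_comm]
  congr 1
  · simp only [mapBase, harmonicH, harmonicT_three, (Fin.castSucc_lt_last _).ne, if_false]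
    rw [Finset.prod_div_distrib, Finset.prod_const, Finset.card_univ, Fintype.card_fin]
    rfl
  · simp [mapBase]

theorem IsBox.cuboidVol_mapBase_nonneg {len : ι → Fin (m + 1) → ℝ} {i : ι} (h : IsBox (len i)) :
    0 ≤ cuboidVol (mapBase (harmonicH 3) (len i)) := by
  rw [cuboidVol_mapBase_harmonicH]
  exact div_nonneg (mul_nonneg h.baseLen.harmonicWeight_nonneg (h _).1.le) (by positivity)

theorem IsBox.cuboidVol_mapBase_le {x : Fin (m + 1) → ℝ} (h : IsBox x) :
    cuboidVol (mapBase (harmonicH 3) x) ≤ cuboidVol x := by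
  have hH : ∀ j, 0 ≤ harmonicH 3 (x j) ∧ harmonicH 3 (x j) ≤ x j := fun j => by
    have h0 := harmonicF_three_nonneg (h j).1.le (h j).2
    have h1 := harmonicF_three_le (h j).1.le (h j).2
    rw [harmonicH, harmonicT_three]
    exact ⟨by positivity, by linarith⟩
  refine Finset.prod_le_prod (fun j _ => ?_) fun j _ => ?_ <;> simp only [mapBase] <;> split_ifs
  exacts [(h j).1.le, (hH j).1, le_rfl, (hH j).2]

theorem IsBox.cuboidVol_le_one {d : ℕ} {x : Fin d → ℝ} (h : IsBox x) : cuboidVol x ≤ 1 :=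
  Finset.prod_le_one (fun j _ => (h j).1.le) fun j _ => (h j).2

theorem MCKS.IsValid.isBox {d : ℕ} {P : MCKS ι d} (hP : P.IsValid) {I : Finset ι}
    (hI : I ∈ P.itemsets) {i : ι} (hi : i ∈ I) : IsBox (P.len i) := fun j =>
  ⟨hP.len_pos I hI i hi j, hP.len_le_one I hI i hi j⟩

theorem MCKS.IsValid.reduce {P : MCKS ι (m + 1)} (hP : P.IsValid) : P.reduce.IsValid where
  disjoint := hP.disjoint
  size_nonneg _ hI _ hi := (hP.isBox hI hi).cuboidVol_mapBase_nonneg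
  size_le_one _ hI _ hi :=
    (hP.isBox hI hi).cuboidVol_mapBase_le.trans (hP.isBox hI hi).cuboidVol_le_one
  profit_nonneg := hP.profit_nonneg

variable [DecidableEq ι]

theorem MCKS.IsValid.isBox_of_isChoice {d : ℕ} {P : MCKS ι d} (hP : P.IsValid) {S : Finset ι}
    (hS : IsChoice P.itemsets S) {i : ι} (hi : i ∈ S) : IsBox (P.len i) := by
  obtain ⟨I, hI, hiI⟩ := Finset.mem_biUnion.1 (hS.1 hi)
  exact hP.isBox hI hiI

/-- Reduced sizes are at most volumes, and the volumes of packed items sum to at most that of the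
cube. So the reduced problem is a relaxation. -/
theorem MCKS.IsValid.isFeasible_reduce {P : MCKS ι (m + 1)} (hP : P.IsValid)
    {B : PackedBin ι (m + 1)} (hB : P.IsFeasible B) : P.reduce.IsFeasible B.items := by
  refine ⟨hB.1, (Finset.sum_le_sum fun i hi => ?_).trans
    (hB.2.sum_cuboidVol_le_one fun i hi j => (hP.isBox_of_isChoice hB.1 hi j).1.le)⟩
  exact (hP.isBox_of_isChoice hB.1 hi).cuboidVol_mapBase_le

end Reduction

/-! ### The approximation guarantee -/

section Guarantee

theorem IsBinPacking.items_subset {d : ℕ} {len : ι → Fin d → ℝ} {J : Finset ι}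
    {L : List (PackedBin ι d)} (h : IsBinPacking len J L) {B : PackedBin ι d} (hB : B ∈ L) :
    B.items ⊆ J := fun i hi => (h.2.2 i).2 ⟨B, hB, hi⟩

theorem mostProfitable_mem_or_eq {d : ℕ} (profit : ι → ℝ) (L : List (PackedBin ι d)) :
    mostProfitable profit L ∈ L ∨ mostProfitable profit L = { items := ∅, pos := 0 } := by
  rw [mostProfitable]
  cases h : L.argmax fun B => ∑ i ∈ B.items, profit i with
  | none => exact Or.inr rfl
  | some B => exact Or.inl (List.argmax_mem h)

theorem le_mostProfitable {d : ℕ} (profit : ι → ℝ) {L : List (PackedBin ι d)} {B : PackedBin ι d}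
    (hB : B ∈ L) :
    ∑ i ∈ B.items, profit i ≤ ∑ i ∈ (mostProfitable profit L).items, profit i := by
  rw [mostProfitable]
  cases h : L.argmax fun B => ∑ i ∈ B.items, profit i with
  | none => exact absurd (List.argmax_eq_none.1 h ▸ hB) List.not_mem_nil
  | some B' => exact List.le_of_mem_argmax hB h

variable [DecidableEq ι]

theorem sum_le_sum_map_of_covered {d : ℕ} {profit : ι → ℝ} {L : List (PackedBin ι d)}
    (hp : ∀ B ∈ L, ∀ i ∈ B.items, 0 ≤ profit i) {J : Finset ι}
    (hJ : ∀ i ∈ J, ∃ B ∈ L, i ∈ B.items) :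
    ∑ i ∈ J, profit i ≤ (L.map fun B => ∑ i ∈ B.items, profit i).sum := by
  induction L generalizing J with
  | nil =>
    obtain rfl : J = ∅ := Finset.eq_empty_of_forall_notMem fun i hi => by simpa using hJ i hi
    simp
  | cons B L ih =>
    rw [List.forall_mem_cons] at hp
    rw [List.map_cons, List.sum_cons, ← Finset.sum_inter_add_sum_sdiff J B.items]
    refine add_le_add (Finset.sum_le_sum_of_subset_of_nonneg Finset.inter_subset_right
      fun i hi _ => hp.1 i hi) (ih hp.2 fun i hi => ?_)
    obtain ⟨hiJ, hiB⟩ := Finset.mem_sdiff.1 hi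
    obtain ⟨B', hB', hi'⟩ := hJ i hiJ
    rcases List.mem_cons.1 hB' with rfl | hB'
    · exact absurd hi' hiB
    · exact ⟨B', hB', hi'⟩

theorem IsBinPacking.sum_profit_le {d : ℕ} {len : ι → Fin d → ℝ} {J : Finset ι}
    {L : List (PackedBin ι d)} (h : IsBinPacking len J L) {profit : ι → ℝ}
    (hp : ∀ i ∈ J, 0 ≤ profit i) :
    ∑ i ∈ J, profit i ≤
      L.length * ∑ i ∈ (mostProfitable profit L).items, profit i := by
  refine (sum_le_sum_map_of_covered (fun B hB i hi => hp i (h.items_subset hB hi))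
    fun i hi => (h.2.2 i).1 hi).trans ?_
  refine (List.sum_le_card_nsmul _ (∑ i ∈ (mostProfitable profit L).items, profit i)
    fun x hx => ?_).trans ?_
  · obtain ⟨B, hB, rfl⟩ := List.mem_map.1 hx
    exact le_mostProfitable profit hB
  · rw [List.length_map, nsmul_eq_mul]

theorem MCKS.IsValid.packBest_isApproxSolution {m : ℕ} {P : MCKS ι (m + 2)} (hP : P.IsValid)
    {α : ℝ} {J : Finset ι} (hJ : P.reduce.IsApproxSolution α J) :
    IsBinPacking P.len J (hdhNF 3 P.len J.toList) ∧
      (hdhNF 3 P.len J.toList).length ≤ 3 ^ (m + 2) ∧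
      P.IsApproxSolution (α / 3 ^ (m + 2)) (P.packBest J) := by
  have hchoice : IsChoice P.itemsets J := hJ.1.1
  have hbox : ∀ i ∈ J, IsBox (P.len i) := fun i hi => hP.isBox_of_isChoice hchoice hi
  have hprofit : ∀ i ∈ J, 0 ≤ P.profit i := fun i hi =>
    hP.reduce.profit_nonneg_of_isChoice hchoice hi
  have hpack := hdhNF_isBinPacking hbox
  have hlen : (hdhNF 3 P.len J.toList).length ≤ 3 ^ (m + 2) := by
    refine hdhNF_length_le J.nodup_toList (fun i hi => hbox i (Finset.mem_toList.1 hi)) ?_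
    have hs : ∑ i ∈ J, cuboidVol (mapBase (harmonicH 3) (P.len i)) ≤ 1 := hJ.1.2
    simp only [cuboidVol_mapBase_harmonicH] at hs
    rw [← Finset.sum_div, div_le_one (by positivity)] at hs
    rwa [Finset.sum_map_toList]
  have hsub : (P.packBest J).items ⊆ J := by
    rcases mostProfitable_mem_or_eq P.profit (hdhNF 3 P.len J.toList) with h | h
    · exact hpack.items_subset h
    · rw [MCKS.packBest, h]
      exact Finset.empty_subset J
  refine ⟨hpack, hlen, ⟨hchoice.mono hsub, ?_⟩, fun B hB => ?_⟩
  · rcases mostProfitable_mem_or_eq P.profit (hdhNF 3 P.len J.toList) with h | h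
    · exact hpack.1 _ h
    · rw [MCKS.packBest, h]
      exact ⟨by simp, by simp⟩
  · have h1 : α * ∑ i ∈ B.items, P.profit i ≤ ∑ i ∈ J, P.profit i :=
      hJ.2 _ (hP.isFeasible_reduce hB)
    have h2 : ∑ i ∈ J, P.profit i ≤ (hdhNF 3 P.len J.toList).length *
      ∑ i ∈ (P.packBest J).items, P.profit i := hpack.sum_profit_le hprofit
    have h3 : 0 ≤ ∑ i ∈ (P.packBest J).items, P.profit i :=
      Finset.sum_nonneg fun i hi => hprofit i (hsub hi)
    have h4 : ((hdhNF 3 P.len J.toList).length : ℝ) ≤ 3 ^ (m + 2) := by exact_mod_cast hlen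
    rw [div_mul_eq_mul_div, div_le_iff₀ (by positivity), mul_comm (∑ i ∈ _, _)]
    exact h1.trans (h2.trans (mul_le_mul_of_nonneg_right h4 h3))

end Guarantee

end

/-- Dimension `d = m + 2 ≥ 2`. -/
theorem mainTheorem5 {ι : Type*} [DecidableEq ι] (m : ℕ) (P : MCKS ι (m + 2)) (hP : P.IsValid)
    (ε : ℝ) (hε0 : 0 < ε) (hε1 : ε < 1) :
    P.IsApproxSolution ((1 - ε) / 3 ^ (m + 2)) (P.hdhKS ε) ∧
      P.reduce.IsApproxSolution (1 - ε) (P.reduce.lawler ε) ∧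
      ∀ J : Finset ι, P.reduce.IsApproxSolution (1 - ε) J →
        IsBinPacking P.len J (hdhNF 3 P.len J.toList) ∧
        (hdhNF 3 P.len J.toList).length ≤ 3 ^ (m + 2) ∧
        P.IsApproxSolution ((1 - ε) / 3 ^ (m + 2)) (P.packBest J) := by
  have h := hP.reduce.lawler_isApproxSolution hε0 hε1.le
  exact ⟨(hP.packBest_isApproxSolution h).2.2, h, fun J hJ => hP.packBest_isApproxSolution hJ⟩
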